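/- Let $A$ be a semisimple artinian ring and let $\mathfrak{C}$ be an $A$-coring, i.e. an $A$-bimodule with $A$-bimodule maps $\Delta:\mathfrak{C}\to\mathfrak{C}\otimes_A\mathfrak{C}$ (coassociative) and $\epsilon:\mathfrak{C}\to A$ (counit). Let $\mathcal{A}$ be a generating set, in the category of right $\mathfrak{C}$-comodules, consisting of finitely generated right $\mathfrak{C}$-comodules. Put $\Sigma=\bigoplus_{P\in\mathcal{A}}P$, with coaction $\rho_\Sigma$, canonical injections $\iota_P:P\to\Sigma$ and projections $\pi_P:\Sigma\to P$; let $T=\mathrm{End}_{\mathfrak{C}}(\Sigma)$ be the ring of comodule endomorphisms of $\Sigma$, and let $\Sigma^*=\mathrm{Hom}_A(\Sigma,A)$ be the dual of the right $A$-module $\Sigma$, an $A$-$T$-bimodule. Then every $P\in\mathcal{A}$ is finitely generated (and projective) as a right $A$-module, so that, choosing for each $P\in\mathcal{A}$ a finite dual basis $\{e^*_{\alpha_P},e_{\alpha_P}\}$ of $P_A$, the $A$-bimodule $\Sigma^*\otimes_T\Sigma$ is an $A$-coring (the infinite comatrix coring associated to $\mathcal{A}$) with $$\Delta(\varphi\otimes_T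 u)=\sum_{P\in\mathcal{A}}\sum_{\alpha_P}\bigl(\varphi\otimes_T\iota_P(e_{\alpha_P})\bigr)\otimes_A\bigl(e^*_{\alpha_P}\pi_P\otimes_T\iota_P\pi_P(u)\bigr),\qquad \epsilon(\varphi\otimes_T u)=\varphi(u),$$ and the canonical map $$\mathsf{can}:\Sigma^*\otimes_T\Sigma\to\mathfrak{C},\qquad \mathsf{can}(\varphi\otimes_T u)=(\varphi\otimes_A\mathfrak{C})\,\rho_\Sigma(u),$$ is an isomorphism of $A$-corings. In particular, every coalgebra over a field is an infinite comatrix coring: if $C$ is a coalgebra over a field $K$, then the category of right $C$-comodules has a generating set consisting of finite-dimensional comodules, and for every such generating set, with $\Sigma$ its coproduct and $T=\mathrm{End}_C(\Sigma)$, the canonical map $\mathsf{can}:\Sigma^*\otimes_T\Sigma\to C$ is an isomorphism of coalgebras. -/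

import Mathlib

open scoped DirectSum TensorProduct
open MulOpposite (op unop)

set_option linter.unusedSectionVars false

noncomputable section

universe u v w x y

/-! ## Tensor products over a noncommutative ring

Right `R`-modules are modules over `Rᵐᵒᵖ`. -/

namespace BTensor

variable (R : Type u) (M : Type v) (N : Type w) [Ring R] [AddCommGroup M] [Module Rᵐᵒᵖ M]
  [AddCommGroup N] [Module R N]

/-- The subgroup of `M ⊗[ℤ] N` generated by the elements `m r ⊗ n - m ⊗ r n`. -/
def rel : AddSubgroup (M ⊗[ℤ] N) :=
  AddSubgroup.closure
    {z | ∃ (m : M) (r : R) (n : N), z = (op r • m) ⊗ₜ[ℤ] n - m ⊗ₜ[ℤ] (r • n)}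

end BTensor

/-- The tensor product `M ⊗_R N` of a right `R`-module `M` and a left `R`-module `N`, for a
not necessarily commutative ring `R`. -/
def BTensor (R : Type u) (M : Type v) (N : Type w) [Ring R] [AddCommGroup M] [Module Rᵐᵒᵖ M]
    [AddCommGroup N] [Module R N] : Type (max v w) :=
  (M ⊗[ℤ] N) ⧸ BTensor.rel R M N

namespace BTensor

section Basic

variable {R : Type u} {M : Type v} {N : Type w} [Ring R] [AddCommGroup M] [Module Rᵐᵒᵖ M]
  [AddCommGroup N] [Module R N]

instance : AddCommGroup (BTensor R M N) :=
  inferInstanceAs (AddCommGroup ((M ⊗[ℤ] N) ⧸ BTensor.rel R M N))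

instance : AddCommMonoid (BTensor R M N) := inferInstance

instance : AddMonoid (BTensor R M N) := inferInstance

instance : AddZeroClass (BTensor R M N) := inferInstance

variable (R) in
/-- The pure tensor `m ⊗ n`. -/
def tmul (m : M) (n : N) : BTensor R M N :=
  QuotientAddGroup.mk' (rel R M N) (m ⊗ₜ[ℤ] n)

theorem add_tmul (m m' : M) (n : N) : tmul R (m + m') n = tmul R m n + tmul R m' n := by
  unfold tmul; rw [TensorProduct.add_tmul, map_add]; rfl

theorem tmul_add (m : M) (n n' : N) : tmul R m (n + n') = tmul R m n + tmul R m n' := by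
  unfold tmul; rw [TensorProduct.tmul_add, map_add]; rfl

theorem smul_tmul (r : R) (m : M) (n : N) : tmul R (op r • m) n = tmul R m (r • n) := by
  refine (QuotientAddGroup.eq_iff_sub_mem).2 ?_
  exact AddSubgroup.subset_closure ⟨m, r, n, rfl⟩

variable (R M N) in
/-- `(m, n) ↦ m ⊗ n` as a biadditive map. -/
def mk : M →+ N →+ BTensor R M N :=
  AddMonoidHom.mk' (fun m => AddMonoidHom.mk' (fun n => tmul R m n) (tmul_add m))
    (fun m m' => by ext n; exact add_tmul m m' n)

theorem mk_apply (m : M) (n : N) : mk R M N m n = tmul R m n := rfl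

@[simp] theorem zero_tmul (n : N) : tmul R (0 : M) n = 0 := by
  rw [← mk_apply, map_zero]; rfl

@[simp] theorem tmul_zero (m : M) : tmul R m (0 : N) = 0 := by
  rw [← mk_apply, map_zero]

theorem sum_tmul {κ : Type*} (s : Finset κ) (f : κ → M) (n : N) :
    tmul R (∑ k ∈ s, f k) n = ∑ k ∈ s, tmul R (f k) n := by
  simp only [← mk_apply, map_sum, AddMonoidHom.finsetSum_apply]

theorem tmul_sum {κ : Type*} (s : Finset κ) (m : M) (f : κ → N) :
    tmul R m (∑ k ∈ s, f k) = ∑ k ∈ s, tmul R m (f k) := by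
  simp only [← mk_apply, map_sum]

theorem induction_on {p : BTensor R M N → Prop} (z : BTensor R M N) (zero : p 0)
    (tmul : ∀ m n, p (tmul R m n)) (add : ∀ a b, p a → p b → p (a + b)) : p z := by
  obtain ⟨t, rfl⟩ := QuotientAddGroup.mk'_surjective _ z
  induction t using TensorProduct.induction_on with
  | zero => rw [map_zero]; exact zero
  | tmul m n => exact tmul m n
  | add a b ha hb => rw [map_add]; exact add _ _ ha hb

theorem hom_ext {G : Type*} [AddCommGroup G] {f g : BTensor R M N →+ G}
    (h : ∀ m n, f (tmul R m n) = g (tmul R m n)) : f = g := by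
  ext z
  induction z using induction_on with
  | zero => simp
  | tmul m n => exact h m n
  | add a b ha hb => rw [map_add, map_add, ha, hb]

/-- The universal property: balanced biadditive maps factor through `M ⊗_R N`. -/
def lift {G : Type*} [AddCommGroup G] (f : M →+ N →+ G)
    (hf : ∀ (m : M) (r : R) (n : N), f (op r • m) n = f m (r • n)) : BTensor R M N →+ G :=
  QuotientAddGroup.lift (rel R M N)
    (TensorProduct.liftAddHom f (fun r m n => by rw [map_zsmul, map_zsmul]; rfl))
    (by
      refine (AddSubgroup.closure_le _).2 ?_
      rintro z ⟨m, r, n, rfl⟩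
      simp only [SetLike.mem_coe, AddMonoidHom.mem_ker, map_sub, TensorProduct.liftAddHom_tmul,
        hf, sub_self])

@[simp] theorem lift_tmul {G : Type*} [AddCommGroup G] (f : M →+ N →+ G)
    (hf : ∀ (m : M) (r : R) (n : N), f (op r • m) n = f m (r • n)) (m : M) (n : N) :
    lift f hf (tmul R m n) = f m n := rfl

end Basic

section Map

variable {R : Type u} [Ring R] {M M' M'' : Type*} [AddCommGroup M] [Module Rᵐᵒᵖ M]
  [AddCommGroup M'] [Module Rᵐᵒᵖ M'] [AddCommGroup M''] [Module Rᵐᵒᵖ M'']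
  {N N' N'' : Type*} [AddCommGroup N] [Module R N] [AddCommGroup N'] [Module R N']
  [AddCommGroup N''] [Module R N'']

/-- The map `f ⊗ g`. -/
def map (f : M →ₗ[Rᵐᵒᵖ] M') (g : N →ₗ[R] N') : BTensor R M N →+ BTensor R M' N' :=
  lift (((mk R M' N').comp f.toAddMonoidHom).compr₂ (AddMonoidHom.id _) |>.compl₂ g.toAddMonoidHom)
    (fun m r n => by
      change tmul R (f (op r • m)) (g n) = tmul R (f m) (g (r • n))
      rw [map_smul, map_smul, smul_tmul])

@[simp] theorem map_tmul (f : M →ₗ[Rᵐᵒᵖ] M') (g : N →ₗ[R] N') (m : M) (n : N) :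
    map f g (tmul R m n) = tmul R (f m) (g n) := rfl

theorem map_map (f' : M' →ₗ[Rᵐᵒᵖ] M'') (g' : N' →ₗ[R] N'') (f : M →ₗ[Rᵐᵒᵖ] M')
    (g : N →ₗ[R] N') (z : BTensor R M N) :
    map f' g' (map f g z) = map (f' ∘ₗ f) (g' ∘ₗ g) z := by
  induction z using induction_on with
  | zero => simp
  | tmul m n => rfl
  | add a b ha hb => simp only [map_add, ha, hb]

theorem map_id_id (z : BTensor R M N) :
    map (LinearMap.id : M →ₗ[Rᵐᵒᵖ] M) (LinearMap.id : N →ₗ[R] N) z = z := by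
  induction z using induction_on with
  | zero => simp
  | tmul m n => rfl
  | add a b ha hb => simp only [map_add, ha, hb]

/-- `M ⊗_R N → N`, `m ⊗ n ↦ φ(m) n`: the map `φ ⊗ N` followed by `R ⊗_R N ≅ N`. -/
def evalLeft (φ : M →ₗ[Rᵐᵒᵖ] R) : BTensor R M N →+ N :=
  lift (AddMonoidHom.mk' (fun m => AddMonoidHom.mk' (fun n => φ m • n) (smul_add _))
    (fun m m' => by ext n; simp [add_smul]))
    (fun m r n => by
      change φ (op r • m) • n = φ m • r • n
      rw [map_smul, MulOpposite.smul_eq_mul_unop, mul_smul]; rfl)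

@[simp] theorem evalLeft_tmul (φ : M →ₗ[Rᵐᵒᵖ] R) (m : M) (n : N) :
    evalLeft φ (tmul R m n) = φ m • n := rfl

/-- `M ⊗_R N → M`, `m ⊗ n ↦ m ψ(n)`: the map `M ⊗ ψ` followed by `M ⊗_R R ≅ M`. -/
def evalRight (ψ : N →ₗ[R] R) : BTensor R M N →+ M :=
  lift (AddMonoidHom.mk' (fun m => AddMonoidHom.mk' (fun n => op (ψ n) • m)
      (fun n n' => by simp [add_smul]))
    (fun m m' => by ext n; simp))
    (fun m r n => by
      change op (ψ n) • op r • m = op (ψ (r • n)) • m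
      rw [map_smul, smul_eq_mul, MulOpposite.op_mul, mul_smul])

@[simp] theorem evalRight_tmul (ψ : N →ₗ[R] R) (m : M) (n : N) :
    evalRight ψ (tmul R m n) = op (ψ n) • m := rfl

end Map

section Actions

variable {R : Type u} [Ring R] {M : Type*} [AddCommGroup M] [Module Rᵐᵒᵖ M]
  {N : Type*} [AddCommGroup N] [Module R N] {S : Type*} [Ring S]

/-- The left action `s (m ⊗ n) = (s m) ⊗ n` on `M ⊗_R N`, for an `S`-`R`-bimodule `M`. -/
instance leftModule [Module S M] [SMulCommClass S Rᵐᵒᵖ M] : Module S (BTensor R M N) where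
  smul s z := map (DistribSMul.toLinearMap Rᵐᵒᵖ M s) LinearMap.id z
  one_smul z := by
    change map (DistribSMul.toLinearMap Rᵐᵒᵖ M (1 : S)) LinearMap.id z = z
    convert map_id_id z
    ext m; exact one_smul S m
  mul_smul s t z := by
    change map (DistribSMul.toLinearMap Rᵐᵒᵖ M (s * t)) LinearMap.id z
      = map (DistribSMul.toLinearMap Rᵐᵒᵖ M s) LinearMap.id
        (map (DistribSMul.toLinearMap Rᵐᵒᵖ M t) LinearMap.id z)
    rw [map_map]
    congr 2
    ext m; exact mul_smul s t m
  smul_zero s := map_zero _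
  smul_add s := map_add _
  add_smul s t z := by
    change map (DistribSMul.toLinearMap Rᵐᵒᵖ M (s + t)) LinearMap.id z
      = map (DistribSMul.toLinearMap Rᵐᵒᵖ M s) LinearMap.id z
        + map (DistribSMul.toLinearMap Rᵐᵒᵖ M t) LinearMap.id z
    induction z using induction_on with
    | zero => simp
    | tmul m n => simp [add_smul, add_tmul]
    | add a b ha hb => simp only [map_add, ha, hb]; abel
  zero_smul z := by
    change map (DistribSMul.toLinearMap Rᵐᵒᵖ M (0 : S)) LinearMap.id z = 0
    induction z using induction_on with
    | zero => simp
    | tmul m n => simp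
    | add a b ha hb => simp only [map_add, ha, hb, add_zero]

variable (R N) in
/-- The right action of `s` on an `R`-`S`-bimodule, as a left `R`-linear map. -/
def rightSMul [Module Sᵐᵒᵖ N] [SMulCommClass R Sᵐᵒᵖ N] (s : Sᵐᵒᵖ) : N →ₗ[R] N where
  toFun n := s • n
  map_add' := smul_add s
  map_smul' r n := (smul_comm r s n).symm

@[simp] theorem rightSMul_apply [Module Sᵐᵒᵖ N] [SMulCommClass R Sᵐᵒᵖ N] (s : Sᵐᵒᵖ) (n : N) :
    rightSMul R N s n = s • n := rfl

/-- The right action `(m ⊗ n) s = m ⊗ (n s)` on `M ⊗_R N`, for an `R`-`S`-bimodule `N`. -/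
instance rightModule [Module Sᵐᵒᵖ N] [SMulCommClass R Sᵐᵒᵖ N] :
    Module Sᵐᵒᵖ (BTensor R M N) where
  smul s z := map LinearMap.id (rightSMul R N s) z
  one_smul z := by
    change map LinearMap.id (rightSMul R N (1 : Sᵐᵒᵖ)) z = z
    convert map_id_id z
    ext m; exact one_smul Sᵐᵒᵖ m
  mul_smul s t z := by
    change map LinearMap.id (rightSMul R N (s * t)) z
      = map LinearMap.id (rightSMul R N s)
        (map LinearMap.id (rightSMul R N t) z)
    rw [map_map]
    congr 2
    ext m; exact mul_smul s t m
  smul_zero s := map_zero _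
  smul_add s := map_add _
  add_smul s t z := by
    change map LinearMap.id (rightSMul R N (s + t)) z
      = map LinearMap.id (rightSMul R N s) z
        + map LinearMap.id (rightSMul R N t) z
    induction z using induction_on with
    | zero => simp
    | tmul m n => simp [add_smul, tmul_add]
    | add a b ha hb => simp only [map_add, ha, hb]; abel
  zero_smul z := by
    change map LinearMap.id (rightSMul R N (0 : Sᵐᵒᵖ)) z = 0
    induction z using induction_on with
    | zero => simp
    | tmul m n => simp
    | add a b ha hb => simp only [map_add, ha, hb, add_zero]

theorem left_smul_tmul [Module S M] [SMulCommClass S Rᵐᵒᵖ M] (s : S) (m : M) (n : N) :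
    s • tmul R m n = tmul R (s • m) n := rfl

theorem right_smul_tmul [Module Sᵐᵒᵖ N] [SMulCommClass R Sᵐᵒᵖ N] (s : Sᵐᵒᵖ) (m : M) (n : N) :
    s • tmul R m n = tmul R m (s • n) := rfl

instance bimodule {S' : Type*} [Ring S'] [Module S M] [SMulCommClass S Rᵐᵒᵖ M]
    [Module S'ᵐᵒᵖ N] [SMulCommClass R S'ᵐᵒᵖ N] : SMulCommClass S S'ᵐᵒᵖ (BTensor R M N) where
  smul_comm s t z := by
    induction z using induction_on with
    | zero => simp
    | tmul m n => simp only [left_smul_tmul, right_smul_tmul]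
    | add a b ha hb => simp only [smul_add, ha, hb]

end Actions

section Assoc

variable {R S : Type*} [Ring R] [Ring S] (M : Type*) [AddCommGroup M] [Module Rᵐᵒᵖ M]
  (N : Type*) [AddCommGroup N] [Module R N] [Module Sᵐᵒᵖ N] [SMulCommClass R Sᵐᵒᵖ N]
  (P : Type*) [AddCommGroup P] [Module S P]

/-- The associativity map `(M ⊗_R N) ⊗_S P → M ⊗_R (N ⊗_S P)`. -/
def assoc : BTensor S (BTensor R M N) P →+ BTensor R M (BTensor S N P) :=
  lift
    (lift
      (AddMonoidHom.mk' (fun m => AddMonoidHom.mk'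
          (fun n => (mk R M (BTensor S N P) m).comp (mk S N P n))
          (fun n n' => by ext p; simp [mk_apply, tmul_add]))
        (fun m m' => by ext n p; simp [mk_apply]))
      (fun m r n => by
        ext p
        change tmul R (op r • m) (tmul S n p) = tmul R m (tmul S (r • n) p)
        rw [smul_tmul, left_smul_tmul]))
    (fun z s p => by
      induction z using induction_on with
      | zero => simp
      | tmul m n =>
        change tmul R m (tmul S (op s • n) p) = tmul R m (tmul S n (s • p))
        rw [smul_tmul]
      | add a b ha hb => simp only [smul_add, map_add, AddMonoidHom.add_apply, ha, hb])

@[simp] theorem assoc_tmul (m : M) (n : N) (p : P) :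
    assoc M N P (tmul S (tmul R m n) p) = tmul R m (tmul S n p) := rfl

end Assoc

end BTensor

/-! ## Corings and comodules -/

/-- An `A`-coring structure on the `A`-bimodule `C`: a comultiplication `Δ : C → C ⊗_A C` and a
counit `ε : C → A`, both `A`-bimodule maps, subject to coassociativity and the counit laws. -/
class Coring (A : Type u) (C : Type v) [Ring A] [AddCommGroup C] [Module A C] [Module Aᵐᵒᵖ C]
    [SMulCommClass A Aᵐᵒᵖ C] where
  comul : C →+ BTensor A C C
  counit : C →+ A
  comul_smul : ∀ (a : A) (c : C), comul (a • c) = a • comul c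
  comul_op_smul : ∀ (a : Aᵐᵒᵖ) (c : C), comul (a • c) = a • comul c
  counit_smul : ∀ (a : A) (c : C), counit (a • c) = a * counit c
  counit_op_smul : ∀ (a : Aᵐᵒᵖ) (c : C), counit (a • c) = counit c * unop a
  coassoc : ∀ c : C,
    BTensor.assoc C C C
        (BTensor.map { comul with map_smul' := comul_op_smul } LinearMap.id (comul c))
      = BTensor.map LinearMap.id { comul with map_smul' := comul_smul } (comul c)
  counit_comul : ∀ c : C,
    BTensor.evalLeft { counit with map_smul' := counit_op_smul } (comul c) = c
  comul_counit : ∀ c : C,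
    BTensor.evalRight { counit with map_smul' := counit_smul } (comul c) = c

namespace Coring

variable (A : Type u) (C : Type v) [Ring A] [AddCommGroup C] [Module A C] [Module Aᵐᵒᵖ C]
  [SMulCommClass A Aᵐᵒᵖ C] [Coring A C]

/-- `Δ` as a left `A`-linear map. -/
def comulL : C →ₗ[A] BTensor A C C := { comul (A := A) with map_smul' := comul_smul }

/-- `ε` as a left `A`-linear map. -/
def counitL : C →ₗ[A] A := { counit (A := A) with map_smul' := counit_smul }

/-- `f` is a homomorphism of `A`-corings: an `A`-bimodule map with `ε ∘ f = ε` and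
`Δ ∘ f = (f ⊗ f) ∘ Δ`. -/
structure IsHom {A : Type u} {C : Type v} {D : Type w} [Ring A]
    [AddCommGroup C] [Module A C] [Module Aᵐᵒᵖ C] [SMulCommClass A Aᵐᵒᵖ C] [Coring A C]
    [AddCommGroup D] [Module A D] [Module Aᵐᵒᵖ D] [SMulCommClass A Aᵐᵒᵖ D] [Coring A D]
    (f : C →+ D) : Prop where
  map_smul : ∀ (a : A) (c : C), f (a • c) = a • f c
  map_op_smul : ∀ (a : Aᵐᵒᵖ) (c : C), f (a • c) = a • f c
  counit_map : ∀ c : C, counit (A := A) (f c) = counit (A := A) c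
  comul_map : ∀ c : C,
    comul (A := A) (f c)
      = BTensor.map { f with map_smul' := map_op_smul } { f with map_smul' := map_smul }
          (comul (A := A) c)

variable {C} in
/-- `f` is an isomorphism of `A`-corings. -/
def IsIso {D : Type w} [AddCommGroup D] [Module A D] [Module Aᵐᵒᵖ D]
    [SMulCommClass A Aᵐᵒᵖ D] [Coring A D] (f : C →+ D) : Prop :=
  IsHom (A := A) f ∧ Function.Bijective f

end Coring

/-- A right comodule structure over the `A`-coring `C` on the right `A`-module `M`. -/
class RightComodule (A : Type u) (C : Type v) (M : Type w) [Ring A] [AddCommGroup C] [Module A C]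
    [Module Aᵐᵒᵖ C] [SMulCommClass A Aᵐᵒᵖ C] [Coring A C] [AddCommGroup M] [Module Aᵐᵒᵖ M] where
  coact : M →ₗ[Aᵐᵒᵖ] BTensor A M C
  coassoc : ∀ m : M,
    BTensor.assoc M C C (BTensor.map coact LinearMap.id (coact m))
      = BTensor.map LinearMap.id (Coring.comulL A C) (coact m)
  coact_counit : ∀ m : M, BTensor.evalRight (Coring.counitL A C) (coact m) = m

/-- The category of right comodules, on objects: a right `A`-module with a right coaction. -/
structure RightComod (A : Type u) (C : Type v) [Ring A] [AddCommGroup C] [Module A C]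
    [Module Aᵐᵒᵖ C] [SMulCommClass A Aᵐᵒᵖ C] [Coring A C] : Type (max u v (w + 1)) where
  carrier : Type w
  [addCommGroup : AddCommGroup carrier]
  [module : Module Aᵐᵒᵖ carrier]
  [comodule : RightComodule A C carrier]

attribute [instance] RightComod.addCommGroup RightComod.module RightComod.comodule

instance (A : Type u) (C : Type v) [Ring A] [AddCommGroup C] [Module A C]
    [Module Aᵐᵒᵖ C] [SMulCommClass A Aᵐᵒᵖ C] [Coring A C] :
    CoeSort (RightComod.{u, v, w} A C) (Type w) := ⟨RightComod.carrier⟩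

section Comodules

variable (A : Type u) (C : Type v) [Ring A] [AddCommGroup C] [Module A C] [Module Aᵐᵒᵖ C]
  [SMulCommClass A Aᵐᵒᵖ C] [Coring A C]

open RightComodule (coact)

section Hom

variable {M : Type*} [AddCommGroup M] [Module Aᵐᵒᵖ M] [RightComodule A C M]
  {N : Type*} [AddCommGroup N] [Module Aᵐᵒᵖ N] [RightComodule A C N]

/-- `f` is a morphism of right `C`-comodules: `ρ_N ∘ f = (f ⊗ C) ∘ ρ_M`. -/
def IsColinear (f : M →ₗ[Aᵐᵒᵖ] N) : Prop :=
  ∀ m : M, coact (A := A) (C := C) (f m) = BTensor.map f LinearMap.id (coact (A := A) (C := C) m)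

/-- `N` is a subcomodule of `M`: `ρ(N)` lies in the image of `N ⊗_A C` in `M ⊗_A C`. -/
def IsSubcomodule (N : Submodule Aᵐᵒᵖ M) : Prop :=
  ∀ m ∈ N, coact (A := A) (C := C) m ∈
    (BTensor.map N.subtype (LinearMap.id : C →ₗ[A] C)).range

variable (M) in
/-- `M` is a finitely generated object of the category of right comodules: whenever `M` is the
sum of an upward directed family of subcomodules, it is equal to one of them. -/
def IsFinGenComodule : Prop :=
  ∀ S : Set (Submodule Aᵐᵒᵖ M), (∀ N ∈ S, IsSubcomodule A C N) → S.Nonempty →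
    DirectedOn (· ≤ ·) S → sSup S = ⊤ → ⊤ ∈ S

variable (M) in
/-- The ring `End_C(M)` of endomorphisms of the right comodule `M`. -/
def colinearEnd : Subring (Module.End Aᵐᵒᵖ M) where
  carrier := {f | IsColinear A C f}
  one_mem' m := (BTensor.map_id_id _).symm
  mul_mem' {f g} hf hg m := by
    change coact (A := A) (C := C) (f (g m)) = BTensor.map (f ∘ₗ g) LinearMap.id _
    rw [hf, hg, BTensor.map_map]; rfl
  zero_mem' m := by
    change coact (A := A) (C := C) (0 : M) = _
    rw [map_zero]
    generalize coact (A := A) (C := C) m = z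
    induction z using BTensor.induction_on with
    | zero => simp
    | tmul m n => simp
    | add a b ha hb => rw [map_add, ← ha, ← hb, add_zero]
  add_mem' {f g} hf hg m := by
    change coact (A := A) (C := C) (f m + g m) = _
    rw [map_add, hf, hg]
    generalize coact (A := A) (C := C) m = z
    induction z using BTensor.induction_on with
    | zero => simp
    | tmul m n => simp [BTensor.add_tmul]
    | add a b ha hb => simp only [map_add, ← ha, ← hb]; abel
  neg_mem' {f} hf m := by
    change coact (A := A) (C := C) (- f m) = _
    rw [map_neg, hf, neg_eq_iff_add_eq_zero]
    generalize coact (A := A) (C := C) m = z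
    induction z using BTensor.induction_on with
    | zero => simp
    | tmul m n => simp [← BTensor.add_tmul]
    | add a b ha hb =>
      rw [map_add, map_add, add_add_add_comm, ha, hb, add_zero]

end Hom

variable {A C} in
/-- The family `P` generates the category of right `C`-comodules: distinct parallel comodule
morphisms are distinguished by a comodule morphism from some `P i`. -/
def IsGenerating {ι : Type x} (P : ι → RightComod.{u, v, w} A C) : Prop :=
  ∀ (M N : RightComod.{u, v, w} A C) (f g : M →ₗ[Aᵐᵒᵖ] N), IsColinear A C f → IsColinear A C g →
    f ≠ g → ∃ (i : ι) (h : P i →ₗ[Aᵐᵒᵖ] M), IsColinear A C h ∧ f ∘ₗ h ≠ g ∘ₗ h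

section DirectSum

variable {ι : Type x} [DecidableEq ι] (P : ι → Type w) [∀ i, AddCommGroup (P i)]
  [∀ i, Module Aᵐᵒᵖ (P i)]

variable {A} in
/-- `f ⊗ C` as a right `A`-linear map. -/
def mapCoring {M : Type*} [AddCommGroup M] [Module Aᵐᵒᵖ M] {N : Type*} [AddCommGroup N]
    [Module Aᵐᵒᵖ N] (f : M →ₗ[Aᵐᵒᵖ] N) : BTensor A M C →ₗ[Aᵐᵒᵖ] BTensor A N C :=
  { BTensor.map f LinearMap.id with
    map_smul' := fun a z => by
      change BTensor.map f LinearMap.id (a • z) = a • BTensor.map f LinearMap.id z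
      induction z using BTensor.induction_on with
      | zero => simp
      | tmul m n => simp [BTensor.right_smul_tmul]
      | add a b ha hb => simp only [smul_add, map_add, ha, hb] }

variable [∀ i, RightComodule A C (P i)]

/-- The coaction of `⨁ i, P i`, determined by those of the `P i`. -/
def directSumCoact : (⨁ i, P i) →ₗ[Aᵐᵒᵖ] BTensor A (⨁ i, P i) C :=
  DirectSum.toModule Aᵐᵒᵖ ι _
    (fun i => mapCoring C (DirectSum.lof Aᵐᵒᵖ ι P i) ∘ₗ coact)

theorem directSumCoact_lof (i : ι) (p : P i) :
    directSumCoact A C P (DirectSum.lof Aᵐᵒᵖ ι P i p)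
      = BTensor.map (DirectSum.lof Aᵐᵒᵖ ι P i) LinearMap.id (coact (A := A) (C := C) p) := by
  unfold directSumCoact
  rw [DirectSum.toModule_lof]; rfl

theorem directSum_induction {p : (⨁ i, P i) → Prop} (z : ⨁ i, P i) (zero : p 0)
    (lof : ∀ i x, p (DirectSum.lof Aᵐᵒᵖ ι P i x)) (add : ∀ a b, p a → p b → p (a + b)) : p z :=
  DirectSum.induction_on z zero lof add

/-- The coproduct of right comodules. -/
instance directSumComodule : RightComodule A C (⨁ i, P i) where
  coact := directSumCoact A C P
  coassoc m := by
    induction m using directSum_induction A P with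
    | zero => simp
    | add a b ha hb => simp only [map_add, ha, hb]
    | lof i p =>
      rw [directSumCoact_lof, BTensor.map_map, BTensor.map_map]
      have h := congrArg (BTensor.map (DirectSum.lof Aᵐᵒᵖ ι P i)
        (LinearMap.id : BTensor A C C →ₗ[A] BTensor A C C)) (RightComodule.coassoc (A := A) (C := C) p)
      rw [BTensor.map_map] at h
      refine Eq.trans ?_ h
      generalize coact (A := A) (C := C) p = z
      induction z using BTensor.induction_on with
      | zero => simp
      | add a b ha hb => simp only [map_add, ha, hb]
      | tmul q c =>
        simp only [BTensor.map_tmul, LinearMap.comp_apply, LinearMap.id_apply,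
          directSumCoact_lof]
        generalize coact (A := A) (C := C) q = y
        induction y using BTensor.induction_on with
        | zero => simp
        | add a b ha hb => simp only [map_add, BTensor.add_tmul, ha, hb]
        | tmul q' c' => rfl
  coact_counit m := by
    induction m using directSum_induction A P with
    | zero => simp
    | add a b ha hb => simp only [map_add, ha, hb]
    | lof i p =>
      rw [directSumCoact_lof]
      conv_rhs => rw [← RightComodule.coact_counit (A := A) (C := C) p]
      generalize coact (A := A) (C := C) p = z
      induction z using BTensor.induction_on with
      | zero => simp
      | add a b ha hb => simp only [map_add, ha, hb]
      | tmul q c => simp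

end DirectSum

end Comodules

/-! ## Infinite comatrix corings -/

section Dual

variable (A : Type u) [Ring A] (M : Type v) [AddCommGroup M] [Module Aᵐᵒᵖ M]

/-- The right dual `M* = Hom_A(M, A)` of a right `A`-module; it is a left `A`-module. -/
abbrev RDual := M →ₗ[Aᵐᵒᵖ] A

instance rdualAddCommGroup : AddCommGroup (RDual A M) := inferInstance

instance rdualAddCommMonoid : AddCommMonoid (RDual A M) := inferInstance

instance rdualLeftModule : Module A (RDual A M) := inferInstance

variable {A M} in
/-- A ring `T` of endomorphisms of `M_A` acts on `M` by evaluation. -/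
instance endModule (T : Subring (Module.End Aᵐᵒᵖ M)) : Module (↥T) M := inferInstance

variable {A M} in
instance endModule_smulCommClass (T : Subring (Module.End Aᵐᵒᵖ M)) :
    SMulCommClass (↥T) Aᵐᵒᵖ M := inferInstance

variable {A M} in
/-- For a ring `T` of endomorphisms of `M_A`, the dual `M*` is a right `T`-module through
`φ t = φ ∘ t`. -/
instance rdualModule (T : Subring (Module.End Aᵐᵒᵖ M)) : Module (↥T)ᵐᵒᵖ (RDual A M) where
  smul t φ := φ ∘ₗ ((unop t : ↥T) : Module.End Aᵐᵒᵖ M)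
  one_smul φ := rfl
  mul_smul s t φ := rfl
  smul_zero t := rfl
  smul_add t φ ψ := rfl
  add_smul s t φ := by ext m; exact map_add φ _ _
  zero_smul φ := by ext m; exact map_zero φ

variable {A M} in
theorem rdual_smul_apply (T : Subring (Module.End Aᵐᵒᵖ M)) (t : (↥T)ᵐᵒᵖ) (φ : RDual A M) (m : M) :
    (t • φ) m = φ (((unop t : ↥T) : Module.End Aᵐᵒᵖ M) m) := rfl

instance rdualBimodule (T : Subring (Module.End Aᵐᵒᵖ M)) :
    SMulCommClass A (↥T)ᵐᵒᵖ (RDual A M) where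
  smul_comm _ _ _ := rfl

/-- A finite dual basis `{e_k, e_k*}` of a right `A`-module: `x = ∑ e_k e_k*(x)`. -/
structure DualBasis where
  n : ℕ
  e : Fin n → M
  d : Fin n → RDual A M
  sum_eq : ∀ m : M, ∑ k, op (d k m) • e k = m

theorem nonempty_dualBasis [Module.Finite Aᵐᵒᵖ M] [Module.Projective Aᵐᵒᵖ M] :
    Nonempty (DualBasis A M) := by
  obtain ⟨n, f, g, -, -, hfg⟩ := Module.Finite.exists_comp_eq_id_of_projective Aᵐᵒᵖ M
  refine ⟨⟨n, fun k => f (Pi.single k 1), fun k =>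
    { toFun := fun m => unop (g m k), map_add' := ?_, map_smul' := ?_ }, ?_⟩⟩
  · intro a b; simp
  · intro a b; simp [MulOpposite.smul_eq_mul_unop]
  · intro m
    have h := LinearMap.congr_fun hfg m
    rw [LinearMap.comp_apply, LinearMap.id_apply] at h
    conv_rhs => rw [← h, LinearMap.pi_apply_eq_sum_univ f (g m)]
    refine Finset.sum_congr rfl (fun k _ => ?_)
    change g m k • _ = _
    congr 2
    ext j; simp [Pi.single_apply, eq_comm]

end Dual

/-- A choice of finite dual basis of a finitely generated projective module. -/
def dualBasis (A : Type u) [Ring A] (M : Type v) [AddCommGroup M] [Module Aᵐᵒᵖ M]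
    [Module.Finite Aᵐᵒᵖ M] [Module.Projective Aᵐᵒᵖ M] : DualBasis A M :=
  Classical.choice (nonempty_dualBasis A M)

namespace Comatrix

variable {A : Type u} [Ring A] {ι : Type x} [DecidableEq ι] {P : ι → Type w}
  [∀ i, AddCommGroup (P i)] [∀ i, Module Aᵐᵒᵖ (P i)]

variable (A P) in
/-- The injection `ι_i : P i → Σ`. -/
abbrev inj (i : ι) : P i →ₗ[Aᵐᵒᵖ] (⨁ i, P i) := DirectSum.lof Aᵐᵒᵖ ι P i

variable (A P) in
/-- The projection `π_i : Σ → P i`. -/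
abbrev proj (i : ι) : (⨁ i, P i) →ₗ[Aᵐᵒᵖ] P i := DirectSum.component Aᵐᵒᵖ ι P i

/-- The ring `T` of endomorphisms of `Σ = ⨁ i, P i` contains all the idempotents `ι_i π_i`. -/
class HasProjections (T : Subring (Module.End Aᵐᵒᵖ (⨁ i, P i))) : Prop where
  mem : ∀ i, inj A P i ∘ₗ proj A P i ∈ T

theorem exists_sum_inj_proj (u : ⨁ i, P i) :
    ∃ F : Finset ι, ∀ G : Finset ι, F ⊆ G → ∑ i ∈ G, inj A P i (proj A P i u) = u := by
  induction u using DirectSum.induction_on with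
  | zero => exact ⟨∅, fun G _ => by simp⟩
  | of i p =>
    refine ⟨{i}, fun G hG => ?_⟩
    rw [Finset.sum_eq_single_of_mem i (hG (Finset.mem_singleton_self i))]
    · change inj A P i (proj A P i (inj A P i p)) = _
      rw [DirectSum.component.lof_self]; rfl
    · intro j _ hj
      change inj A P j (proj A P j (inj A P i p)) = _
      rw [DirectSum.component.of, dif_neg (Ne.symm hj), map_zero]
  | add a b ha hb =>
    obtain ⟨F, hF⟩ := ha
    obtain ⟨F', hF'⟩ := hb
    refine ⟨F ∪ F', fun G hG => ?_⟩
    simp only [map_add, Finset.sum_add_distrib]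
    rw [hF G (Finset.union_subset_left hG), hF' G (Finset.union_subset_right hG)]

theorem proj_inj (i : ι) (p : P i) : proj A P i (inj A P i p) = p :=
  DirectSum.component.lof_self _ _ _

variable (T : Subring (Module.End Aᵐᵒᵖ (⨁ i, P i)))

/-- The underlying `A`-bimodule `Σ* ⊗_T Σ` of the comatrix coring. -/
abbrev Carrier := BTensor (↥T) (RDual A (⨁ i, P i)) (⨁ i, P i)

instance carrierAddCommGroup : AddCommGroup (Carrier T) := inferInstance

instance carrierLeftModule : Module A (Carrier T) := BTensor.leftModule

instance carrierRightModule : Module Aᵐᵒᵖ (Carrier T) := BTensor.rightModule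

instance carrierBimodule : SMulCommClass A Aᵐᵒᵖ (Carrier T) := BTensor.bimodule

/-- `T` acts on `Σ* ⊗_T Σ` trivially in the middle. -/
theorem tmul_end {t : Module.End Aᵐᵒᵖ (⨁ i, P i)} (ht : t ∈ T) (φ : RDual A (⨁ i, P i))
    (u : ⨁ i, P i) : BTensor.tmul (↥T) (φ ∘ₗ t) u = BTensor.tmul (↥T) φ (t u) :=
  BTensor.smul_tmul (⟨t, ht⟩ : ↥T) φ u

variable [∀ i, Module.Finite Aᵐᵒᵖ (P i)] [∀ i, Module.Projective Aᵐᵒᵖ (P i)]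

/-- For `φ ∈ Σ*` and `p ∈ P i`, the element
`∑_k (φ ⊗_T ι_i(e_k)) ⊗_A (e_k* π_i ⊗_T ι_i(p))`, where `{e_k, e_k*}` is a dual basis of `P i`. -/
def preComulAt (i : ι) :
    RDual A (⨁ i, P i) →+ P i →+ BTensor A (Carrier T) (Carrier T) :=
  AddMonoidHom.mk' (fun φ => AddMonoidHom.mk' (fun p =>
      ∑ k, BTensor.tmul A (BTensor.tmul (↥T) φ (inj A P i ((dualBasis A (P i)).e k)))
        (BTensor.tmul (↥T) ((dualBasis A (P i)).d k ∘ₗ proj A P i) (inj A P i p)))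
      (fun p q => by
        simp only [map_add, BTensor.tmul_add, Finset.sum_add_distrib]))
    (fun φ ψ => by
      ext p
      simp [BTensor.add_tmul, Finset.sum_add_distrib])

theorem preComulAt_apply (i : ι) (φ : RDual A (⨁ i, P i)) (p : P i) :
    preComulAt T i φ p =
      ∑ k, BTensor.tmul A (BTensor.tmul (↥T) φ (inj A P i ((dualBasis A (P i)).e k)))
        (BTensor.tmul (↥T) ((dualBasis A (P i)).d k ∘ₗ proj A P i) (inj A P i p)) := rfl

/-- `(φ, u) ↦ ∑_i ∑_k (φ ⊗_T ι_i(e_k)) ⊗_A (e_k* π_i ⊗_T ι_i π_i(u))`. -/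
def preComul : RDual A (⨁ i, P i) →+ (⨁ i, P i) →+ BTensor A (Carrier T) (Carrier T) :=
  AddMonoidHom.mk' (fun φ => DirectSum.toAddMonoid (fun i => preComulAt T i φ))
    (fun φ ψ => by
      ext i p
      simp)

theorem preComul_inj (i : ι) (φ : RDual A (⨁ i, P i)) (p : P i) :
    preComul T φ (inj A P i p) = preComulAt T i φ p :=
  DirectSum.toAddMonoid_of _ _ _

theorem preComul_eq_sum (φ : RDual A (⨁ i, P i)) (u : ⨁ i, P i) (F : Finset ι)
    (hF : ∑ i ∈ F, inj A P i (proj A P i u) = u) :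
    preComul T φ u = ∑ i ∈ F, preComulAt T i φ (proj A P i u) := by
  conv_lhs => rw [← hF]
  rw [map_sum]
  exact Finset.sum_congr rfl (fun i _ => preComul_inj T i φ _)

theorem dualBasis_comp (i : ι) (ψ : RDual A (⨁ i, P i)) :
    ψ ∘ₗ (inj A P i ∘ₗ proj A P i) =
      ∑ l, ψ (inj A P i ((dualBasis A (P i)).e l)) • ((dualBasis A (P i)).d l ∘ₗ proj A P i) := by
  refine LinearMap.ext (fun u => ?_)
  rw [LinearMap.sum_apply]
  conv_lhs => rw [LinearMap.comp_apply, LinearMap.comp_apply,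
    ← (dualBasis A (P i)).sum_eq (proj A P i u)]
  simp only [map_sum, map_smul]
  rfl

theorem preComul_balanced [HasProjections T] (φ : RDual A (⨁ i, P i)) (t : ↥T)
    (u : ⨁ i, P i) : preComul T (op t • φ) u = preComul T φ (t • u) := by
  induction u using DirectSum.induction_on with
  | zero => rw [smul_zero, map_zero, map_zero]
  | add a b ha hb => rw [smul_add, map_add, map_add, ha, hb]
  | of i p =>
    change preComul T (φ ∘ₗ (t : Module.End Aᵐᵒᵖ (⨁ i, P i))) (inj A P i p)
      = preComul T φ ((t : Module.End Aᵐᵒᵖ (⨁ i, P i)) (inj A P i p))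
    obtain ⟨t, ht⟩ := t
    dsimp only
    let B := dualBasis A (P i)
    obtain ⟨F, hF⟩ := exists_sum_inj_proj (A := A) (t (inj A P i p))
    choose F' hF' using fun k => exists_sum_inj_proj (A := A) (t (inj A P i (B.e k)))
    let G := F ∪ Finset.univ.biUnion F'
    have hG1 := hF G Finset.subset_union_left
    have hG2 : ∀ k, ∑ j ∈ G, inj A P j (proj A P j (t (inj A P i (B.e k))))
        = t (inj A P i (B.e k)) := fun k => hF' k G
      ((Finset.subset_biUnion_of_mem F' (Finset.mem_univ k)).trans Finset.subset_union_right)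
    have key : ∀ j, preComulAt T j φ (proj A P j (t (inj A P i p)))
        = ∑ l, BTensor.tmul A
            (BTensor.tmul (↥T) φ (inj A P j (proj A P j (t (inj A P i (B.e l))))))
            (BTensor.tmul (↥T) (B.d l ∘ₗ proj A P i) (inj A P i p)) := by
      intro j
      rw [preComulAt_apply]
      let E := dualBasis A (P j)
      have h1 : ∀ k, BTensor.tmul (↥T) (E.d k ∘ₗ proj A P j)
            (inj A P j (proj A P j (t (inj A P i p))))
          = ∑ l, (E.d k (proj A P j (t (inj A P i (B.e l))))) •
              BTensor.tmul (↥T) (B.d l ∘ₗ proj A P i) (inj A P i p) := by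
        intro k
        have e1 : E.d k ∘ₗ proj A P j
            = (E.d k ∘ₗ proj A P j) ∘ₗ (inj A P j ∘ₗ proj A P j) := by
          refine LinearMap.ext (fun x => ?_)
          simp only [LinearMap.comp_apply, proj_inj]
        have e2 := tmul_end T (HasProjections.mem (T := T) j) (E.d k ∘ₗ proj A P j)
          (t (inj A P i p))
        rw [← e1] at e2
        have e3 := tmul_end T ht (E.d k ∘ₗ proj A P j) (inj A P i p)
        have e4 := tmul_end T (HasProjections.mem (T := T) i)
          ((E.d k ∘ₗ proj A P j) ∘ₗ t) (inj A P i p)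
        rw [LinearMap.comp_apply (inj A P i), proj_inj, dualBasis_comp, BTensor.sum_tmul] at e4
        rw [LinearMap.comp_apply] at e2
        rw [← e2, ← e3, ← e4]
        rfl
      refine (Finset.sum_congr rfl (fun k _ => by
        rw [h1 k, BTensor.tmul_sum])).trans ?_
      rw [Finset.sum_comm]
      refine Finset.sum_congr rfl (fun l _ => ?_)
      simp only [← BTensor.smul_tmul, BTensor.right_smul_tmul]
      rw [← BTensor.sum_tmul, ← BTensor.tmul_sum]
      congr 2
      simp only [← map_smul, ← map_sum]
      rw [E.sum_eq]
    rw [preComul_inj, preComulAt_apply, preComul_eq_sum T φ _ G hG1]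
    simp only [key]
    rw [Finset.sum_comm]
    refine Finset.sum_congr rfl (fun l _ => ?_)
    rw [← BTensor.sum_tmul, ← BTensor.tmul_sum, hG2 l, tmul_end T ht]

/-- The comultiplication of `Σ* ⊗_T Σ`:
`Δ(φ ⊗_T u) = ∑_i ∑_k (φ ⊗_T ι_i(e_k)) ⊗_A (e_k* π_i ⊗_T ι_i π_i(u))`. -/
def comul [HasProjections T] : Carrier T →+ BTensor A (Carrier T) (Carrier T) :=
  BTensor.lift (preComul T) (fun φ t u => preComul_balanced T φ t u)

theorem comul_tmul_inj [HasProjections T] (i : ι) (φ : RDual A (⨁ i, P i)) (p : P i) :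
    comul T (BTensor.tmul (↥T) φ (inj A P i p)) =
      ∑ k, BTensor.tmul A (BTensor.tmul (↥T) φ (inj A P i ((dualBasis A (P i)).e k)))
        (BTensor.tmul (↥T) ((dualBasis A (P i)).d k ∘ₗ proj A P i) (inj A P i p)) :=
  preComul_inj T i φ p

theorem carrier_induction {T : Subring (Module.End Aᵐᵒᵖ (⨁ i, P i))} {p : Carrier T → Prop}
    (z : Carrier T) (zero : p 0)
    (tmul : ∀ φ i x, p (BTensor.tmul (↥T) φ (inj A P i x)))
    (add : ∀ a b, p a → p b → p (a + b)) : p z := by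
  induction z using BTensor.induction_on with
  | zero => exact zero
  | add a b ha hb => exact add a b ha hb
  | tmul φ u =>
    induction u using DirectSum.induction_on with
    | zero => rw [BTensor.tmul_zero]; exact zero
    | of i x => exact tmul φ i x
    | add a b ha hb => rw [BTensor.tmul_add]; exact add _ _ ha hb

/-- The counit of `Σ* ⊗_T Σ`: evaluation `φ ⊗_T u ↦ φ(u)`. -/
def counit : Carrier T →+ A :=
  BTensor.lift
    (AddMonoidHom.mk' (fun φ => φ.toAddMonoidHom) (fun _ _ => rfl))
    (fun _ _ _ => rfl)

theorem counit_tmul (φ : RDual A (⨁ i, P i)) (u : ⨁ i, P i) :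
    counit T (BTensor.tmul (↥T) φ u) = φ u := rfl

theorem comul_left [HasProjections T] (a : A) (z : Carrier T) :
    comul T (a • z) = a • comul T z := by
  induction z using carrier_induction with
  | zero => rw [smul_zero, map_zero, smul_zero]
  | add x y hx hy => rw [smul_add, map_add, map_add, smul_add, hx, hy]
  | tmul φ i x =>
    rw [BTensor.left_smul_tmul, comul_tmul_inj, comul_tmul_inj, Finset.smul_sum]
    rfl

theorem comul_right [HasProjections T] (a : Aᵐᵒᵖ) (z : Carrier T) :
    comul T (a • z) = a • comul T z := by
  induction z using carrier_induction with
  | zero => rw [smul_zero, map_zero, smul_zero]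
  | add x y hx hy => rw [smul_add, map_add, map_add, smul_add, hx, hy]
  | tmul φ i x =>
    rw [BTensor.right_smul_tmul, ← map_smul, comul_tmul_inj, comul_tmul_inj, Finset.smul_sum]
    refine Finset.sum_congr rfl (fun k _ => ?_)
    rw [map_smul, BTensor.right_smul_tmul, BTensor.right_smul_tmul]

theorem counit_left (a : A) (z : Carrier T) : counit T (a • z) = a * counit T z := by
  induction z using BTensor.induction_on with
  | zero => rw [smul_zero, map_zero, mul_zero]
  | add x y hx hy => rw [smul_add, map_add, map_add, mul_add, hx, hy]
  | tmul φ u => rfl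

theorem counit_right (a : Aᵐᵒᵖ) (z : Carrier T) :
    counit T (a • z) = counit T z * unop a := by
  induction z using BTensor.induction_on with
  | zero => rw [smul_zero, map_zero, zero_mul]
  | add x y hx hy => rw [smul_add, map_add, map_add, add_mul, hx, hy]
  | tmul φ u =>
    rw [BTensor.right_smul_tmul, counit_tmul, counit_tmul, map_smul]; rfl

/-- The infinite comatrix coring `Σ* ⊗_T Σ`, where `Σ = ⨁ i, P i` for a family of finitely
generated projective right `A`-modules, and `T` is a ring of endomorphisms of `Σ` containing the
idempotents `ι_i π_i`. -/
instance coring [HasProjections T] : Coring A (Carrier T) where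
  comul := comul T
  counit := counit T
  comul_smul := comul_left T
  comul_op_smul := comul_right T
  counit_smul := counit_left T
  counit_op_smul := counit_right T
  coassoc z := by
    induction z using carrier_induction with
    | zero => simp only [map_zero]
    | add x y hx hy => simp only [map_add, hx, hy]
    | tmul φ i x =>
      rw [comul_tmul_inj]
      simp only [map_sum]
      let X := fun k => BTensor.tmul (↥T) φ (inj A P i ((dualBasis A (P i)).e k))
      let Y := fun k => BTensor.tmul (↥T) ((dualBasis A (P i)).d k ∘ₗ proj A P i) (inj A P i x)
      change ∑ k, BTensor.assoc _ _ _ (BTensor.tmul A (comul T (X k)) (Y k))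
        = ∑ k, BTensor.tmul A (X k) (comul T (Y k))
      simp only [X, Y, comul_tmul_inj, BTensor.sum_tmul, BTensor.tmul_sum, map_sum,
        BTensor.assoc_tmul]
      rw [Finset.sum_comm]
  counit_comul z := by
    induction z using carrier_induction with
    | zero => simp only [map_zero]
    | add x y hx hy => simp only [map_add, hx, hy]
    | tmul φ i x =>
      rw [comul_tmul_inj, map_sum]
      have e := tmul_end T (HasProjections.mem (T := T) i) φ (inj A P i x)
      rw [LinearMap.comp_apply (inj A P i), proj_inj, dualBasis_comp, BTensor.sum_tmul] at e
      exact e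
  comul_counit z := by
    induction z using carrier_induction with
    | zero => simp only [map_zero]
    | add x y hx hy => simp only [map_add, hx, hy]
    | tmul φ i x =>
      rw [comul_tmul_inj, map_sum]
      conv_rhs => rw [← (dualBasis A (P i)).sum_eq x, map_sum, BTensor.tmul_sum]
      refine Finset.sum_congr rfl (fun k _ => ?_)
      rw [map_smul, ← BTensor.right_smul_tmul]
      have h : counit T (BTensor.tmul (↥T) ((dualBasis A (P i)).d k ∘ₗ proj A P i) (inj A P i x))
          = (dualBasis A (P i)).d k x := by
        rw [counit_tmul, LinearMap.comp_apply, proj_inj]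
      rw [← h]
      rfl

end Comatrix

/-! ## The canonical map -/

section Can

variable (A : Type u) (C : Type v) [Ring A] [AddCommGroup C] [Module A C] [Module Aᵐᵒᵖ C]
  [SMulCommClass A Aᵐᵒᵖ C] [Coring A C]

theorem BTensor.evalLeft_map {M N : Type*} [AddCommGroup M] [Module Aᵐᵒᵖ M] [AddCommGroup N]
    [Module Aᵐᵒᵖ N] (φ : RDual A N) (f : M →ₗ[Aᵐᵒᵖ] N) (z : BTensor A M C) :
    BTensor.evalLeft φ (BTensor.map f LinearMap.id z) = BTensor.evalLeft (φ ∘ₗ f) z := by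
  induction z using BTensor.induction_on with
  | zero => simp only [map_zero]
  | tmul m c => rfl
  | add a b ha hb => simp only [map_add, ha, hb]

theorem BTensor.evalLeft_add {M : Type*} [AddCommGroup M] [Module Aᵐᵒᵖ M]
    (φ ψ : RDual A M) (z : BTensor A M C) :
    BTensor.evalLeft (φ + ψ) z = BTensor.evalLeft φ z + BTensor.evalLeft ψ z := by
  induction z using BTensor.induction_on with
  | zero => simp only [map_zero, add_zero]
  | tmul m c => exact add_smul _ _ _
  | add a b ha hb => simp only [map_add, ha, hb]; abel

/-- The canonical map `M* ⊗_T M → C`, `φ ⊗_T u ↦ (φ ⊗_A C) ρ_M(u)`, of a right `C`-comodule `M`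
with `T = End_C(M)`. -/
def can (M : Type w) [AddCommGroup M] [Module Aᵐᵒᵖ M] [RightComodule A C M] :
    BTensor (↥(colinearEnd A C M)) (RDual A M) M →+ C :=
  BTensor.lift
    (AddMonoidHom.mk'
      (fun φ => (BTensor.evalLeft φ).comp (RightComodule.coact (C := C)).toAddMonoidHom)
      (fun φ ψ => by ext u; exact BTensor.evalLeft_add A C φ ψ _))
    (fun φ t u => by
      change BTensor.evalLeft (φ ∘ₗ (t : Module.End Aᵐᵒᵖ M)) (RightComodule.coact (C := C) u)
        = BTensor.evalLeft φ (RightComodule.coact (C := C) ((t : Module.End Aᵐᵒᵖ M) u))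
      rw [t.2 u, BTensor.evalLeft_map])

theorem can_tmul (M : Type w) [AddCommGroup M] [Module Aᵐᵒᵖ M] [RightComodule A C M]
    (φ : RDual A M) (u : M) :
    can A C M (BTensor.tmul _ φ u)
      = BTensor.evalLeft φ (RightComodule.coact (A := A) (C := C) u) := rfl

/-- The endomorphism ring of a coproduct of comodules contains the idempotents `ι_i π_i`. -/
instance hasProjections_colinearEnd {ι : Type x} [DecidableEq ι] (P : ι → Type w)
    [∀ i, AddCommGroup (P i)] [∀ i, Module Aᵐᵒᵖ (P i)] [∀ i, RightComodule A C (P i)] :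
    Comatrix.HasProjections (colinearEnd A C (⨁ i, P i)) where
  mem i u := by
    induction u using DirectSum.induction_on with
    | zero => simp only [map_zero]
    | add a b ha hb => simp only [map_add, ha, hb]
    | of j p =>
      change directSumCoact A C P ((Comatrix.inj A P i) (Comatrix.proj A P i
        (Comatrix.inj A P j p))) = BTensor.map _ _ (directSumCoact A C P (Comatrix.inj A P j p))
      rw [directSumCoact_lof A C P j, BTensor.map_map]
      by_cases h : j = i
      · subst h
        rw [Comatrix.proj_inj, directSumCoact_lof]
        congr 2
        refine LinearMap.ext (fun x => ?_)
        simp only [LinearMap.comp_apply, Comatrix.proj_inj]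
      · have h0 : ∀ x, Comatrix.proj A P i (Comatrix.inj A P j x) = 0 := fun x => by
          rw [DirectSum.component.of, dif_neg h]
        rw [h0, map_zero, map_zero]
        have hz : (Comatrix.inj A P i ∘ₗ Comatrix.proj A P i) ∘ₗ DirectSum.lof Aᵐᵒᵖ ι P j = 0 :=
          LinearMap.ext (fun x => by
            simp only [LinearMap.comp_apply, h0, map_zero, LinearMap.zero_apply])
        rw [hz]
        generalize RightComodule.coact (A := A) (C := C) p = z
        induction z using BTensor.induction_on with
        | zero => simp only [map_zero]
        | tmul m c => simp
        | add a b ha hb => rw [map_add, ← ha, ← hb, add_zero]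

end Can

/-- Every module over a semisimple ring is projective. -/
instance projective_of_semisimple (A : Type u) [Ring A] [IsSemisimpleRing A] (M : Type v)
    [AddCommGroup M] [Module Aᵐᵒᵖ M] : Module.Projective Aᵐᵒᵖ M :=
  Module.projective_of_isSemisimpleRing Aᵐᵒᵖ M

/-- The canonical map `Σ* ⊗_T Σ → C`, for `Σ = ⨁ i, P i` and `T = End_C(Σ)`, is an isomorphism of
`A`-corings from the infinite comatrix coring to `C`. -/
def CanIsIso {A : Type u} {C : Type v} [Ring A] [AddCommGroup C] [Module A C] [Module Aᵐᵒᵖ C]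
    [SMulCommClass A Aᵐᵒᵖ C] [Coring A C] {ι : Type x} [DecidableEq ι]
    (P : ι → RightComod.{u, v, w} A C) [∀ i, Module.Finite Aᵐᵒᵖ (P i)]
    [∀ i, Module.Projective Aᵐᵒᵖ (P i)] : Prop :=
  Coring.IsIso A (can A C (⨁ i, P i))

/-! ## Coalgebras as corings -/

section Coalgebra

variable (K : Type u) (C : Type v) [CommRing K] [AddCommGroup C] [Module K C] [Module Kᵐᵒᵖ C]
  [IsCentralScalar K C]

/-- The canonical map `C ⊗[K] C → C ⊗_K C`. -/
def toBTensor (D : Type w) [AddCommGroup D] [Module K D] : C ⊗[K] D →+ BTensor K C D :=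
  TensorProduct.liftAddHom (BTensor.mk K C D) (fun r m n => by
    change BTensor.tmul K (r • m) n = BTensor.tmul K m (r • n)
    rw [← op_smul_eq_smul, BTensor.smul_tmul])

@[simp] theorem toBTensor_tmul (D : Type w) [AddCommGroup D] [Module K D] (c : C) (d : D) :
    toBTensor K C D (c ⊗ₜ[K] d) = BTensor.tmul K c d := rfl

theorem toBTensor_smul (D : Type w) [AddCommGroup D] [Module K D] (a : K) (z : C ⊗[K] D) :
    toBTensor K C D (a • z) = a • toBTensor K C D z := by
  induction z using TensorProduct.induction_on with
  | zero => simp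
  | tmul c d => rfl
  | add x y hx hy => rw [smul_add, map_add, map_add, smul_add, hx, hy]

theorem toBTensor_op_smul (a : Kᵐᵒᵖ) (z : C ⊗[K] C) :
    toBTensor K C C (unop a • z) = a • toBTensor K C C z := by
  induction z using TensorProduct.induction_on with
  | zero => simp
  | tmul c d =>
    rw [← TensorProduct.tmul_smul, toBTensor_tmul, toBTensor_tmul, BTensor.right_smul_tmul,
      ← op_smul_eq_smul, MulOpposite.op_unop]
  | add x y hx hy => rw [smul_add, map_add, map_add, smul_add, hx, hy]

/-- The canonical map `C ⊗[K] (C ⊗[K] C) → C ⊗_K (C ⊗_K C)`. -/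
def toBTensor₃ : C ⊗[K] (C ⊗[K] C) →+ BTensor K C (BTensor K C C) :=
  (BTensor.map LinearMap.id
    ({ toBTensor K C C with map_smul' := toBTensor_smul K C C } :
      C ⊗[K] C →ₗ[K] BTensor K C C)).comp (toBTensor K C (C ⊗[K] C))

/-- A coalgebra over the commutative ring `K` is a `K`-coring on which the left and right actions
of `K` agree. -/
instance coringOfCoalgebra [Coalgebra K C] : Coring K C where
  comul := (toBTensor K C C).comp (Coalgebra.comul (R := K) (A := C)).toAddMonoidHom
  counit := (Coalgebra.counit (R := K) (A := C)).toAddMonoidHom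
  comul_smul a c := by
    change toBTensor K C C (Coalgebra.comul (a • c)) = _
    rw [map_smul, toBTensor_smul]; rfl
  comul_op_smul a c := by
    change toBTensor K C C (Coalgebra.comul (a • c)) = _
    have h : a • c = unop a • c := op_smul_eq_smul (unop a) c
    rw [h, map_smul, toBTensor_op_smul]; rfl
  counit_smul a c := (Coalgebra.counit (R := K) (A := C)).map_smul a c
  counit_op_smul a c := by
    change Coalgebra.counit (R := K) (a • c) = Coalgebra.counit (R := K) c * _
    have h : a • c = unop a • c := op_smul_eq_smul (unop a) c
    rw [h, map_smul, smul_eq_mul, mul_comm]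
  coassoc c := by
    have key := congrArg (toBTensor₃ K C) (Coalgebra.coassoc_apply (R := K) c)
    change BTensor.assoc C C C (BTensor.map _ _ (toBTensor K C C (Coalgebra.comul c)))
      = BTensor.map _ _ (toBTensor K C C (Coalgebra.comul c))
    refine Eq.trans ?_ (key.trans ?_)
    · generalize Coalgebra.comul (R := K) c = z
      induction z using TensorProduct.induction_on with
      | zero => simp only [map_zero]
      | add x y hx hy => simp only [map_add, hx, hy]
      | tmul a b =>
        change BTensor.assoc C C C (BTensor.tmul K (toBTensor K C C (Coalgebra.comul a)) b)
          = toBTensor₃ K C (TensorProduct.assoc K C C C (Coalgebra.comul a ⊗ₜ[K] b))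
        generalize Coalgebra.comul (R := K) a = w
        induction w using TensorProduct.induction_on with
        | zero => simp only [map_zero, BTensor.zero_tmul, TensorProduct.zero_tmul]
        | add x y hx hy => simp only [map_add, BTensor.add_tmul, TensorProduct.add_tmul, hx, hy]
        | tmul p q => rfl
    · generalize Coalgebra.comul (R := K) c = z
      induction z using TensorProduct.induction_on with
      | zero => simp only [map_zero]
      | add x y hx hy => simp only [map_add, hx, hy]
      | tmul a b => rfl
  counit_comul c := by
    have key := congrArg (TensorProduct.lid K C) (Coalgebra.rTensor_counit_comul (R := K) c)
    rw [TensorProduct.lid_tmul, one_smul] at key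
    refine Eq.trans ?_ key
    change BTensor.evalLeft _ (toBTensor K C C (Coalgebra.comul c)) = _
    generalize Coalgebra.comul (R := K) c = z
    induction z using TensorProduct.induction_on with
    | zero => simp only [map_zero]
    | add x y hx hy => simp only [map_add, hx, hy]
    | tmul a b => rfl
  comul_counit c := by
    have key := congrArg (TensorProduct.rid K C) (Coalgebra.lTensor_counit_comul (R := K) c)
    rw [TensorProduct.rid_tmul, one_smul] at key
    refine Eq.trans ?_ key
    change BTensor.evalRight _ (toBTensor K C C (Coalgebra.comul c)) = _
    generalize Coalgebra.comul (R := K) c = z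
    induction z using TensorProduct.induction_on with
    | zero => simp only [map_zero]
    | add x y hx hy => simp only [map_add, hx, hy]
    | tmul a b =>
      change op (Coalgebra.counit (R := K) b) • a = Coalgebra.counit (R := K) b • a
      exact op_smul_eq_smul _ _

end Coalgebra

/-! ## Evaluation of tensors -/

namespace BTensor

section Eval

variable {R : Type*} [Ring R] {M M' N N' : Type*} [AddCommGroup M] [Module Rᵐᵒᵖ M]
  [AddCommGroup M'] [Module Rᵐᵒᵖ M'] [AddCommGroup N] [Module R N] [AddCommGroup N'] [Module R N']

/-! Over a semisimple `A` the left module `C` is projective, so a tensor in `M ⊗_A C` is determined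
by its contractions with left linear functionals `ξ : C → A`. Each `ξ` acts on a right comodule `M`
by `m ↦ (M ⊗ ξ) ρ(m)`, and the subcomodules are exactly the submodules stable under these operators
(`isSubcomodule_iff`). Hence sums of subcomodules, and images and kernels of comodule maps, are
subcomodules. By coassociativity the orbit of `m` under all `ξ` is a subcomodule. It contains `m` by
the counit law, and it is finitely generated over `A` because `A` is noetherian. A comodule is thus
a directed union of `A`-finite subcomodules, and a finitely generated one is `A`-finite
(`IsFinGenComodule.finite`).

If the `P i` generate, every comodule is the sum of the images of comodule maps from the `P i`
(`IsGenerating.iSup_range_eq_top`); otherwise the quotient by that sum would be separated from zero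
by no `P i`.

Comodule maps `M → C` correspond to functionals `φ ∈ M*`: `φ` gives `(φ ⊗ C) ρ_M`, and composing
with the counit goes back (`counit_coeffMap`, `coeffMap_counit_comp`). In this language `can (φ ⊗
u)` is the value at `u` of the map attached to `φ`. Surjectivity is then the statement that `C` is
the sum of the images of the `P i`.

For injectivity, let `∑ φ_k ⊗ u_k` be killed by `can`. Then `(u_k)` lies in the kernel `K` of the
comodule map `Σ^κ → C` attached to `(φ_k)`. Since `K` is generated by the `P i`, the tuple is a sum
of tuples `(t_k(v))`, where the `t_k ∈ T` are the components of a comodule map `Σ → K`. Applying the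
counit gives `∑ φ_k t_k = 0`, so `∑ φ_k ⊗ t_k(v) = ∑ φ_k t_k ⊗ v = 0`
(`IsGenerating.sum_tmul_proj_eq_zero`). -/

theorem evalRight_map (ψ : N' →ₗ[R] R) (f : M →ₗ[Rᵐᵒᵖ] M') (g : N →ₗ[R] N')
    (z : BTensor R M N) : evalRight ψ (map f g z) = f (evalRight (ψ ∘ₗ g) z) := by
  induction z using induction_on with
  | zero => simp only [map_zero]
  | tmul m n => exact (f.map_smul _ _).symm
  | add a b ha hb => simp only [map_add, ha, hb]

theorem evalRight_add (ψ χ : N →ₗ[R] R) (z : BTensor R M N) :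
    evalRight (ψ + χ) z = evalRight ψ z + evalRight χ z := by
  induction z using induction_on with
  | zero => simp only [map_zero, add_zero]
  | tmul m n => simp [add_smul]
  | add a b ha hb => simp only [map_add, ha, hb]; abel

theorem evalRight_zero (z : BTensor R M N) : evalRight (0 : N →ₗ[R] R) z = 0 := by
  induction z using induction_on with
  | zero => simp only [map_zero]
  | tmul m n => simp
  | add a b ha hb => simp only [map_add, ha, hb, add_zero]

theorem smul_evalRight (a : Rᵐᵒᵖ) (ψ : N →ₗ[R] R) (z : BTensor R M N) :
    a • evalRight ψ z = evalRight (rightSMul R R a ∘ₗ ψ) z := by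
  induction z using induction_on with
  | zero => simp only [map_zero, smul_zero]
  | tmul m n => exact (mul_smul a (op (ψ n)) m).symm
  | add a b ha hb => simp only [map_add, smul_add, ha, hb]

/-- The evaluation `M ⊗_R N → M` as a left linear map, for a bimodule `M`. -/
def evalRightₗ {S : Type*} [Ring S] [Module S M] [SMulCommClass S Rᵐᵒᵖ M] (ψ : N →ₗ[R] R) :
    BTensor R M N →ₗ[S] M :=
  { evalRight ψ with
    map_smul' := fun s z => by
      change evalRight ψ (s • z) = s • evalRight ψ z
      induction z using induction_on with
      | zero => simp only [smul_zero, map_zero]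
      | tmul m n => exact (smul_comm s (op (ψ n)) m).symm
      | add a b ha hb => simp only [smul_add, map_add, ha, hb] }

theorem evalRight_evalRight [Module Rᵐᵒᵖ N] [SMulCommClass R Rᵐᵒᵖ N] (η : N →ₗ[R] R)
    (ξ : N' →ₗ[R] R) (z : BTensor R (BTensor R M N) N') :
    evalRight η (evalRight ξ z)
      = evalRight (η ∘ₗ evalRightₗ ξ) (assoc M N N' z) := by
  induction z using induction_on with
  | zero => simp only [map_zero]
  | add a b ha hb => simp only [map_add, ha, hb]
  | tmul y n =>
    induction y using induction_on with
    | zero => simp only [zero_tmul, map_zero]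
    | add a b ha hb => simp only [add_tmul, map_add, ha, hb]
    | tmul m c => rfl

/-- The left legs of any finite expression of `z` serve for all `ξ` at once. This uniformity is what
bounds the subcomodule generated by an element. -/
theorem exists_finset_evalRight_mem_span (z : BTensor R M N) :
    ∃ s : Finset M, ∀ ξ : N →ₗ[R] R, evalRight ξ z ∈ Submodule.span Rᵐᵒᵖ (s : Set M) := by
  classical
  induction z using induction_on with
  | zero => exact ⟨∅, fun ξ => by rw [map_zero]; exact zero_mem _⟩
  | tmul m n =>
    exact ⟨{m}, fun ξ => Submodule.smul_mem _ _ (Submodule.subset_span (by simp))⟩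
  | add a b ha hb =>
    obtain ⟨s, hs⟩ := ha
    obtain ⟨t, ht⟩ := hb
    refine ⟨s ∪ t, fun ξ => ?_⟩
    rw [map_add]
    exact add_mem (Submodule.span_mono (by simp) (hs ξ)) (Submodule.span_mono (by simp) (ht ξ))

/-- Here `s` is a section of the free cover of `N`, so the coordinates `lapply x ∘ s` and the
elements `x` form a possibly infinite dual basis of `N`. Allowing every `G` containing `F` lets the
finite sets of two summands be merged. -/
theorem exists_finset_sum_tmul_evalRight (s : N →ₗ[R] (N →₀ R))
    (hs : ∀ n, (s n).sum (fun x r => r • x) = n) (z : BTensor R M N) :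
    ∃ F : Finset N, ∀ G : Finset N, F ⊆ G →
      ∑ x ∈ G, tmul R (evalRight (Finsupp.lapply x ∘ₗ s) z) x = z := by
  classical
  induction z using induction_on with
  | zero => exact ⟨∅, fun G _ => by simp⟩
  | tmul m n =>
    refine ⟨(s n).support, fun G hG => ?_⟩
    conv_rhs => rw [← hs n, Finsupp.sum_of_support_subset _ hG _ (by simp), tmul_sum]
    exact Finset.sum_congr rfl (fun x _ => smul_tmul _ _ _)
  | add a b ha hb =>
    obtain ⟨F, hF⟩ := ha
    obtain ⟨F', hF'⟩ := hb
    refine ⟨F ∪ F', fun G hG => ?_⟩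
    simp only [map_add, add_tmul, Finset.sum_add_distrib]
    rw [hF G (Finset.union_subset_left hG), hF' G (Finset.union_subset_right hG)]

/-- A dual basis of the projective module `N` rewrites `z` with contractions of `z` as left legs; if
these lie in `L`, so does the whole tensor. This replaces a condition on tensors by one on elements
of `M`. -/
theorem mem_range_map_subtype_iff [Module.Projective R N] (L : Submodule Rᵐᵒᵖ M)
    (z : BTensor R M N) :
    z ∈ (map L.subtype (LinearMap.id : N →ₗ[R] N)).range ↔
      ∀ ξ : N →ₗ[R] R, evalRight ξ z ∈ L := by
  constructor
  · rintro ⟨y, rfl⟩ ξ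
    rw [evalRight_map]
    exact (evalRight _ y).2
  · intro h
    obtain ⟨s, hs⟩ := Module.projective_def.1 (inferInstance : Module.Projective R N)
    obtain ⟨F, hF⟩ := exists_finset_sum_tmul_evalRight s (fun n => by
      simpa [Finsupp.linearCombination_apply] using hs n) z
    rw [← hF F subset_rfl]
    exact sum_mem fun x _ => ⟨tmul R (⟨_, h _⟩ : L) x, rfl⟩

theorem map_injective_of_leftInverse {f : M →ₗ[Rᵐᵒᵖ] M'} {r : M' →ₗ[Rᵐᵒᵖ] M}
    (h : r ∘ₗ f = LinearMap.id) :
    Function.Injective (map f (LinearMap.id : N →ₗ[R] N)) := fun y z e => by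
  have := congrArg (map r LinearMap.id) e
  rwa [map_map, map_map, h, LinearMap.id_comp, map_id_id, map_id_id] at this

theorem map_zero_left (g : N →ₗ[R] N') (z : BTensor R M N) :
    map (0 : M →ₗ[Rᵐᵒᵖ] M') g z = 0 := by
  induction z using induction_on with
  | zero => simp only [map_zero]
  | tmul m n => simp
  | add a b ha hb => simp only [map_add, ha, hb, add_zero]

end Eval

end BTensor

/-! ## Subcomodules and quotients -/

section Subcomodules

variable {A : Type u} {C : Type v} [Ring A] [AddCommGroup C] [Module A C] [Module Aᵐᵒᵖ C]
  [SMulCommClass A Aᵐᵒᵖ C] [Coring A C]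

open RightComodule (coact)

variable {M : Type*} [AddCommGroup M] [Module Aᵐᵒᵖ M] [RightComodule A C M]
  {N : Type*} [AddCommGroup N] [Module Aᵐᵒᵖ N] [RightComodule A C N]

theorem IsColinear.comp {L : Type*} [AddCommGroup L] [Module Aᵐᵒᵖ L] [RightComodule A C L]
    {g : N →ₗ[Aᵐᵒᵖ] L} {f : M →ₗ[Aᵐᵒᵖ] N} (hg : IsColinear A C g) (hf : IsColinear A C f) :
    IsColinear A C (g ∘ₗ f) := fun m => by
  rw [LinearMap.comp_apply, hg, hf, BTensor.map_map]; rfl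

theorem isColinear_zero : IsColinear A C (0 : M →ₗ[Aᵐᵒᵖ] N) := fun m => by
  rw [BTensor.map_zero_left, LinearMap.zero_apply, map_zero]

theorem isSubcomodule_iff [Module.Projective A C] (L : Submodule Aᵐᵒᵖ M) :
    IsSubcomodule A C L ↔
      ∀ m ∈ L, ∀ ξ : C →ₗ[A] A, BTensor.evalRight ξ (coact (A := A) (C := C) m) ∈ L :=
  forall₂_congr fun _ _ => BTensor.mem_range_map_subtype_iff L _

theorem IsSubcomodule.iSup [Module.Projective A C] {κ : Sort*} {L : κ → Submodule Aᵐᵒᵖ M}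
    (h : ∀ k, IsSubcomodule A C (L k)) : IsSubcomodule A C (⨆ k, L k) := by
  rw [isSubcomodule_iff]
  intro m hm ξ
  induction hm using Submodule.iSup_induction' with
  | mem k x hx => exact Submodule.mem_iSup_of_mem k ((isSubcomodule_iff _).1 (h k) x hx ξ)
  | zero => rw [map_zero, map_zero]; exact zero_mem _
  | add x y _ _ hx hy => rw [map_add, map_add]; exact add_mem hx hy

theorem IsSubcomodule.sup [Module.Projective A C] {L L' : Submodule Aᵐᵒᵖ M}
    (h : IsSubcomodule A C L) (h' : IsSubcomodule A C L') : IsSubcomodule A C (L ⊔ L') := by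
  rw [sup_eq_iSup]
  exact IsSubcomodule.iSup fun b => by cases b <;> assumption

theorem IsColinear.isSubcomodule_range [Module.Projective A C] {f : M →ₗ[Aᵐᵒᵖ] N}
    (hf : IsColinear A C f) : IsSubcomodule A C (LinearMap.range f) := by
  rw [isSubcomodule_iff]
  rintro _ ⟨m, rfl⟩ ξ
  rw [hf, BTensor.evalRight_map]
  exact ⟨_, rfl⟩

theorem IsColinear.isSubcomodule_ker [Module.Projective A C] {f : M →ₗ[Aᵐᵒᵖ] N}
    (hf : IsColinear A C f) : IsSubcomodule A C (LinearMap.ker f) := by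
  rw [isSubcomodule_iff]
  intro m hm ξ
  have h := BTensor.evalRight_map ξ f LinearMap.id (coact (A := A) (C := C) m)
  rw [← hf m, LinearMap.mem_ker.1 hm, map_zero, map_zero] at h
  exact h.symm

/-- By coassociativity, two successive operators compose to the operator of a convolution product of
`ξ` and `η`. This makes the orbit of an element stable under all operators. -/
theorem evalRight_coact_evalRight_coact (η ξ : C →ₗ[A] A) (m : M) :
    BTensor.evalRight η (coact (A := A) (C := C)
        (BTensor.evalRight ξ (coact (A := A) (C := C) m)))
      = BTensor.evalRight (η ∘ₗ BTensor.evalRightₗ ξ ∘ₗ Coring.comulL A C)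
        (coact (A := A) (C := C) m) := by
  have h := BTensor.evalRight_map ξ (coact (A := A) (C := C) (M := M)) LinearMap.id
    (coact (A := A) (C := C) m)
  rw [LinearMap.comp_id] at h
  rw [← h, BTensor.evalRight_evalRight, RightComodule.coassoc, BTensor.evalRight_map]
  rfl

variable (A C) in
/-- The subcomodule generated by an element. -/
def cyclicSubcomodule (m : M) : Submodule Aᵐᵒᵖ M where
  carrier := Set.range fun ξ : C →ₗ[A] A => BTensor.evalRight ξ (coact (A := A) (C := C) m)
  zero_mem' := ⟨0, BTensor.evalRight_zero _⟩
  add_mem' := by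
    rintro _ _ ⟨ξ, rfl⟩ ⟨η, rfl⟩
    exact ⟨ξ + η, BTensor.evalRight_add _ _ _⟩
  smul_mem' := by
    rintro a _ ⟨ξ, rfl⟩
    exact ⟨_, (BTensor.smul_evalRight a ξ _).symm⟩

theorem mem_cyclicSubcomodule (m : M) : m ∈ cyclicSubcomodule A C m :=
  ⟨Coring.counitL A C, RightComodule.coact_counit m⟩

theorem isSubcomodule_cyclicSubcomodule [Module.Projective A C] (m : M) :
    IsSubcomodule A C (cyclicSubcomodule A C m) := by
  rw [isSubcomodule_iff]
  rintro _ ⟨ξ, rfl⟩ η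
  exact ⟨_, (evalRight_coact_evalRight_coact η ξ m).symm⟩

theorem fg_cyclicSubcomodule [IsNoetherianRing Aᵐᵒᵖ] (m : M) :
    (cyclicSubcomodule A C m).FG := by
  obtain ⟨s, hs⟩ := BTensor.exists_finset_evalRight_mem_span (coact (A := A) (C := C) m)
  have hle : cyclicSubcomodule A C m ≤ Submodule.span Aᵐᵒᵖ (s : Set M) := by
    rintro _ ⟨ξ, rfl⟩
    exact hs ξ
  exact Submodule.FG.of_le (Submodule.fg_span s.finite_toSet) hle

/-- The `A`-finite subcomodules form a directed family, being closed under binary sums, and they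
cover `M` because each `m` lies in its cyclic subcomodule. Finite generation of the comodule then
puts `M` itself in the family. -/
theorem IsFinGenComodule.finite [Module.Projective A C] [IsNoetherianRing Aᵐᵒᵖ]
    (h : IsFinGenComodule A C M) : Module.Finite Aᵐᵒᵖ M := by
  have hcyc : ∀ m : M, IsSubcomodule A C (cyclicSubcomodule A C m) ∧
      (cyclicSubcomodule A C m).FG := fun m =>
    ⟨isSubcomodule_cyclicSubcomodule m, fg_cyclicSubcomodule m⟩
  let S : Set (Submodule Aᵐᵒᵖ M) := {L | IsSubcomodule A C L ∧ L.FG}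
  have hdir : DirectedOn (· ≤ ·) S := fun L hL L' hL' =>
    ⟨L ⊔ L', ⟨hL.1.sup hL'.1, hL.2.sup hL'.2⟩, le_sup_left, le_sup_right⟩
  have htop : ⊤ ∈ S := h S (fun L hL => hL.1) ⟨_, hcyc 0⟩ hdir
    (eq_top_iff.2 fun m _ => le_sSup (show _ ∈ S from hcyc m) (mem_cyclicSubcomodule m))
  exact ⟨htop.2⟩

/-! ### Transport of coactions -/

/-- No coassociativity of `cX` or `cY` is assumed, so the identity can carry that law along `j`:
back along a split injection, and forward along a quotient map. -/
theorem assoc_map_coact_natural {X Y : Type*} [AddCommGroup X] [Module Aᵐᵒᵖ X] [AddCommGroup Y]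
    [Module Aᵐᵒᵖ Y] (cX : X →ₗ[Aᵐᵒᵖ] BTensor A X C) (cY : Y →ₗ[Aᵐᵒᵖ] BTensor A Y C)
    (j : X →ₗ[Aᵐᵒᵖ] Y) (h : ∀ x, cY (j x) = BTensor.map j LinearMap.id (cX x))
    (z : BTensor A X C) :
    BTensor.assoc Y C C (BTensor.map cY LinearMap.id (BTensor.map j LinearMap.id z))
      = BTensor.map j LinearMap.id (BTensor.assoc X C C (BTensor.map cX LinearMap.id z)) := by
  induction z using BTensor.induction_on with
  | zero => simp only [map_zero]
  | add a b ha hb => simp only [map_add, ha, hb]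
  | tmul x c =>
    simp only [BTensor.map_tmul, h, LinearMap.id_apply]
    generalize cX x = y
    induction y using BTensor.induction_on with
    | zero => simp only [map_zero, BTensor.zero_tmul]
    | add a b ha hb => simp only [map_add, BTensor.add_tmul, ha, hb]
    | tmul x' c' => rfl

/-- A comodule structure induced along a split injection onto a subcomodule. -/
@[reducible]
def RightComodule.ofInjective {X : Type*} [AddCommGroup X] [Module Aᵐᵒᵖ X]
    (j : X →ₗ[Aᵐᵒᵖ] M) (r : M →ₗ[Aᵐᵒᵖ] X) (hr : r ∘ₗ j = LinearMap.id)
    (hj : ∀ x, coact (A := A) (C := C) (j x) ∈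
      (BTensor.map j (LinearMap.id : C →ₗ[A] C)).range) : RightComodule A C X :=
  -- On the image of `j ⊗ C` the map `r ⊗ C` is inverse to `j ⊗ C`, so `j` is colinear for the
  -- transported coaction although `r` is only `A`-linear.
  have key : ∀ x, coact (A := A) (C := C) (j x) = BTensor.map j LinearMap.id
      ((mapCoring C r ∘ₗ coact (A := A) (C := C) ∘ₗ j) x) := fun x => by
    obtain ⟨z, hz⟩ := hj x
    change _ = BTensor.map j LinearMap.id (BTensor.map r LinearMap.id (coact (j x)))
    rw [← hz, BTensor.map_map r, hr, LinearMap.id_comp, BTensor.map_id_id]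
  { coact := mapCoring C r ∘ₗ coact (A := A) (C := C) ∘ₗ j
    coassoc := fun x => by
      apply BTensor.map_injective_of_leftInverse hr
      rw [← assoc_map_coact_natural _ _ j key, ← key, RightComodule.coassoc, key,
        BTensor.map_map, BTensor.map_map]
      rfl
    coact_counit := fun x => by
      have h := RightComodule.coact_counit (A := A) (C := C) (j x)
      rw [key, BTensor.evalRight_map] at h
      have h' := congrArg r h
      rw [← LinearMap.comp_apply, ← LinearMap.comp_apply r j, hr] at h'
      exact h' }

theorem RightComodule.isColinear_ofInjective {X : Type*} [AddCommGroup X] [Module Aᵐᵒᵖ X]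
    (j : X →ₗ[Aᵐᵒᵖ] M) (r : M →ₗ[Aᵐᵒᵖ] X) (hr : r ∘ₗ j = LinearMap.id)
    (hj : ∀ x, coact (A := A) (C := C) (j x) ∈
      (BTensor.map j (LinearMap.id : C →ₗ[A] C)).range) :
    letI := RightComodule.ofInjective j r hr hj
    IsColinear A C j := fun x => by
  obtain ⟨z, hz⟩ := hj x
  change _ = BTensor.map j LinearMap.id (BTensor.map r LinearMap.id (coact (j x)))
  rw [← hz, BTensor.map_map r, hr, LinearMap.id_comp, BTensor.map_id_id]

/-- Semisimplicity provides the `A`-linear retraction. An arbitrary injection `j`, and not only an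
inclusion, is allowed so that the structure can also be moved to a coordinate space. -/
theorem exists_rightComodule_of_injective [IsSemisimpleRing A] {X : Type*} [AddCommGroup X]
    [Module Aᵐᵒᵖ X] (j : X →ₗ[Aᵐᵒᵖ] M) (hinj : Function.Injective j)
    (hj : IsSubcomodule A C (LinearMap.range j)) :
    ∃ _ : RightComodule A C X, IsColinear A C j := by
  obtain ⟨r, hr⟩ := IsSemisimpleModule.extension_property j hinj LinearMap.id
  have hj' : ∀ x, coact (A := A) (C := C) (j x) ∈
      (BTensor.map j (LinearMap.id : C →ₗ[A] C)).range := fun x => by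
    -- The witness `z` lives in `range j ⊗ C` and is pulled back to `X ⊗ C` along the isomorphism of
    -- `X` with its image.
    obtain ⟨z, hz⟩ := hj (j x) ⟨x, rfl⟩
    let e := LinearEquiv.ofInjective j hinj
    refine ⟨BTensor.map e.symm.toLinearMap LinearMap.id z, ?_⟩
    rw [← hz, BTensor.map_map]
    congr 2
    refine LinearMap.ext fun y => ?_
    exact congrArg Subtype.val (e.apply_symm_apply y)
  exact ⟨_, RightComodule.isColinear_ofInjective j r hr hj'⟩

/-- The quotient of a comodule by a subcomodule. -/
@[reducible]
def RightComodule.quotient (L : Submodule Aᵐᵒᵖ M) (hL : IsSubcomodule A C L) :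
    RightComodule A C (M ⧸ L) :=
  let cQ : (M ⧸ L) →ₗ[Aᵐᵒᵖ] BTensor A (M ⧸ L) C :=
    -- For `m ∈ L` the coaction comes from `L ⊗ C`, which dies in `(M ⧸ L) ⊗ C`.
    L.liftQ (mapCoring C L.mkQ ∘ₗ coact (A := A) (C := C)) fun m hm => by
      obtain ⟨z, hz⟩ := hL m hm
      change BTensor.map L.mkQ LinearMap.id (coact m) = 0
      have h0 : L.mkQ ∘ₗ L.subtype = 0 :=
        LinearMap.ext fun x => (Submodule.Quotient.mk_eq_zero L).2 x.2
      rw [← hz, BTensor.map_map, h0, BTensor.map_zero_left]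
  have key : ∀ m, cQ (L.mkQ m) = BTensor.map L.mkQ LinearMap.id (coact (A := A) (C := C) m) :=
    fun _ => rfl
  { coact := cQ
    coassoc := fun x => by
      obtain ⟨m, rfl⟩ := L.mkQ_surjective x
      rw [key, assoc_map_coact_natural _ _ _ key, RightComodule.coassoc, BTensor.map_map,
        BTensor.map_map]
      rfl
    coact_counit := fun x => by
      obtain ⟨m, rfl⟩ := L.mkQ_surjective x
      rw [key, BTensor.evalRight_map]
      exact congrArg L.mkQ (RightComodule.coact_counit (A := A) (C := C) m) }

theorem RightComodule.isColinear_mkQ (L : Submodule Aᵐᵒᵖ M) (hL : IsSubcomodule A C L) :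
    letI := RightComodule.quotient L hL
    IsColinear A C L.mkQ := fun _ => rfl

end Subcomodules

/-! ## Generators of the category of comodules -/

section Generators

variable {A C : Type u} [Ring A] [AddCommGroup C] [Module A C] [Module Aᵐᵒᵖ C]
  [SMulCommClass A Aᵐᵒᵖ C] [Coring A C]

/-- A generating family of comodules generates every comodule as a sum of images. -/
theorem IsGenerating.iSup_range_eq_top [Module.Projective A C] {ι : Type x}
    {P : ι → RightComod.{u, u, w} A C} (hP : IsGenerating P) (N : RightComod.{u, u, w} A C) :
    ⨆ h : {h : Σ i, P i →ₗ[Aᵐᵒᵖ] N // IsColinear A C h.2}, LinearMap.range h.1.2 = ⊤ := by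
  set L : Submodule Aᵐᵒᵖ N :=
    ⨆ h : {h : Σ i, P i →ₗ[Aᵐᵒᵖ] N // IsColinear A C h.2}, LinearMap.range h.1.2 with hLdef
  have hL : IsSubcomodule A C L := IsSubcomodule.iSup fun h => h.2.isSubcomodule_range
  let _ := RightComodule.quotient L hL
  by_contra hne
  have hq : L.mkQ ≠ 0 := fun h0 => hne (by rw [← L.ker_mkQ, h0, LinearMap.ker_zero])
  obtain ⟨i, h, hh, hne'⟩ := hP N ⟨N ⧸ L⟩ L.mkQ 0 (RightComodule.isColinear_mkQ L hL)
    isColinear_zero hq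
  refine hne' (LinearMap.ext fun p => ?_)
  have hp : h p ∈ L := Submodule.mem_iSup_of_mem
    (p := fun h : {h : Σ i, P i →ₗ[Aᵐᵒᵖ] N // IsColinear A C h.2} => LinearMap.range h.1.2)
    ⟨⟨i, h⟩, hh⟩ ⟨p, rfl⟩
  exact (Submodule.Quotient.mk_eq_zero L).2 hp

/-- This is the form in which generation is used: with `N = C` for surjectivity of `can`, and with
`N` a kernel for injectivity. -/
theorem IsGenerating.induction [Module.Projective A C] {ι : Type x}
    {P : ι → RightComod.{u, u, w} A C} (hP : IsGenerating P) {N : RightComod.{u, u, w} A C}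
    {p : N → Prop} (n : N) (zero : p 0)
    (map : ∀ i (h : P i →ₗ[Aᵐᵒᵖ] N), IsColinear A C h → ∀ x, p (h x))
    (add : ∀ a b, p a → p b → p (a + b)) : p n := by
  have hn : n ∈ (⊤ : Submodule Aᵐᵒᵖ N) := trivial
  rw [← hP.iSup_range_eq_top N] at hn
  induction hn using Submodule.iSup_induction' with
  | mem h x hx =>
    obtain ⟨y, rfl⟩ := hx
    exact map _ _ h.2 y
  | zero => exact zero
  | add a b _ _ ha hb => exact add a b ha hb

end Generators

/-! ### Injections and projections of a coproduct are comodule maps. -/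

section DirectSum

variable {A : Type u} {C : Type v} [Ring A] [AddCommGroup C] [Module A C] [Module Aᵐᵒᵖ C]
  [SMulCommClass A Aᵐᵒᵖ C] [Coring A C] {ι : Type x} [DecidableEq ι] {P : ι → Type w}
  [∀ i, AddCommGroup (P i)] [∀ i, Module Aᵐᵒᵖ (P i)] [∀ i, RightComodule A C (P i)]
  {M : Type*} [AddCommGroup M] [Module Aᵐᵒᵖ M] [RightComodule A C M]

theorem isColinear_inj (i : ι) : IsColinear A C (Comatrix.inj A P i) :=
  directSumCoact_lof A C P i

theorem isColinear_of_comp_inj {f : (⨁ i, P i) →ₗ[Aᵐᵒᵖ] M}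
    (h : ∀ i, IsColinear A C (f ∘ₗ Comatrix.inj A P i)) : IsColinear A C f := fun u => by
  induction u using directSum_induction A P with
  | zero => simp only [map_zero]
  | add a b ha hb => simp only [map_add, ha, hb]
  | lof i p => rw [isColinear_inj i p, BTensor.map_map]; exact h i p

theorem isColinear_proj (i : ι) : IsColinear A C (Comatrix.proj A P i) := by
  refine isColinear_of_comp_inj fun j => ?_
  by_cases h : j = i
  · subst h
    have e : Comatrix.proj A P j ∘ₗ Comatrix.inj A P j = LinearMap.id :=
      LinearMap.ext fun p => Comatrix.proj_inj (A := A) j p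
    rw [e]
    exact fun p => (BTensor.map_id_id _).symm
  · have e : Comatrix.proj A P i ∘ₗ Comatrix.inj A P j = 0 := LinearMap.ext fun p => by
      rw [LinearMap.comp_apply, DirectSum.component.of, dif_neg h, LinearMap.zero_apply]
    rw [e]
    exact isColinear_zero

end DirectSum

/-! ## The coring as a comodule, and coefficient maps -/

section Coefficients

variable {A : Type u} {C : Type v} [Ring A] [AddCommGroup C] [Module A C] [Module Aᵐᵒᵖ C]
  [SMulCommClass A Aᵐᵒᵖ C] [Coring A C]

open RightComodule (coact)

variable (A C) in
/-- A coring is a right comodule over itself. -/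
instance Coring.rightComodule : RightComodule A C C where
  coact := { Coring.comul (A := A) with map_smul' := Coring.comul_op_smul }
  coassoc := Coring.coassoc
  coact_counit := Coring.comul_counit

variable {M : Type*} [AddCommGroup M] [Module Aᵐᵒᵖ M] [RightComodule A C M]

theorem BTensor.evalLeft_smul {N : Type*} [AddCommGroup N] [Module A N] [Module Aᵐᵒᵖ N]
    [SMulCommClass A Aᵐᵒᵖ N] (φ : RDual A M) (a : Aᵐᵒᵖ) (z : BTensor A M N) :
    BTensor.evalLeft φ (a • z) = a • BTensor.evalLeft φ z := by
  induction z using BTensor.induction_on with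
  | zero => simp only [smul_zero, map_zero]
  | tmul m c => exact smul_comm (φ m) a c
  | add a b ha hb => simp only [smul_add, map_add, ha, hb]

variable (C) in
/-- The map `M → C`, `m ↦ (φ ⊗_A C) ρ_M(m)`, attached to `φ : M → A`. -/
def coeffMap (φ : RDual A M) : M →ₗ[Aᵐᵒᵖ] C :=
  { (BTensor.evalLeft φ).comp (coact (A := A) (C := C)).toAddMonoidHom with
    map_smul' := fun a m => by
      change BTensor.evalLeft φ (coact (C := C) (a • m)) = a • BTensor.evalLeft φ (coact m)
      rw [map_smul, BTensor.evalLeft_smul] }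

theorem coeffMap_apply (φ : RDual A M) (m : M) :
    coeffMap C φ m = BTensor.evalLeft φ (coact (A := A) (C := C) m) := rfl

/-- Left linearity of `Δ` gives `Δ (φ ⊗ C) ρ = (φ ⊗ C ⊗ C)(M ⊗ Δ) ρ` (`h1`). Coassociativity turns
`(M ⊗ Δ) ρ` into `(ρ ⊗ C) ρ`, whose contraction by `φ` is `h2`. -/
theorem isColinear_coeffMap (φ : RDual A M) : IsColinear A C (coeffMap C φ) := fun m => by
  have h1 : ∀ z : BTensor A M C, Coring.comul (A := A) (BTensor.evalLeft φ z)
      = BTensor.evalLeft φ (BTensor.map LinearMap.id (Coring.comulL A C) z) := fun z => by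
    induction z using BTensor.induction_on with
    | zero => simp only [map_zero]
    | add a b ha hb => simp only [map_add, ha, hb]
    | tmul m c => exact Coring.comul_smul _ _
  have h2 : ∀ z : BTensor A M C,
      BTensor.evalLeft φ (BTensor.assoc M C C (BTensor.map coact LinearMap.id z))
        = BTensor.map (coeffMap C φ) LinearMap.id z := fun z => by
    induction z using BTensor.induction_on with
    | zero => simp only [map_zero]
    | add a b ha hb => simp only [map_add, ha, hb]
    | tmul m c =>
      rw [BTensor.map_tmul, BTensor.map_tmul, coeffMap_apply]
      generalize coact (A := A) (C := C) m = y
      induction y using BTensor.induction_on with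
      | zero => simp only [map_zero, BTensor.zero_tmul]
      | add a b ha hb => simp only [map_add, BTensor.add_tmul, ha, hb]
      | tmul m' c' => rfl
  rw [← h2, RightComodule.coassoc, ← h1]
  rfl

theorem counit_coeffMap (φ : RDual A M) (m : M) :
    Coring.counit (A := A) (coeffMap C φ m) = φ m := by
  conv_rhs => rw [← RightComodule.coact_counit (A := A) (C := C) m]
  rw [coeffMap_apply]
  generalize coact (A := A) (C := C) m = z
  induction z using BTensor.induction_on with
  | zero => simp only [map_zero]
  | add a b ha hb => simp only [map_add, ha, hb]
  | tmul m c =>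
    rw [BTensor.evalLeft_tmul, BTensor.evalRight_tmul, Coring.counit_smul, map_smul]
    rfl

variable (A C) in
/-- The counit as a right linear map. -/
def counitR : RDual A C := { Coring.counit (A := A) with map_smul' := Coring.counit_op_smul }

/-- Colinearity of `f` reduces this to the left counit law in `C`. With `counit_coeffMap` it
identifies `M*` with the comodule maps `M → C`. -/
theorem coeffMap_counit_comp {f : M →ₗ[Aᵐᵒᵖ] C} (hf : IsColinear A C f) (m : M) :
    coeffMap C (counitR A C ∘ₗ f) m = f m := by
  rw [coeffMap_apply, ← BTensor.evalLeft_map, ← hf]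
  exact Coring.counit_comul (f m)

theorem coeffMap_comp {N : Type*} [AddCommGroup N] [Module Aᵐᵒᵖ N] [RightComodule A C N]
    {f : M →ₗ[Aᵐᵒᵖ] N} (hf : IsColinear A C f) (φ : RDual A N) (m : M) :
    coeffMap C (φ ∘ₗ f) m = coeffMap C φ (f m) := by
  rw [coeffMap_apply, coeffMap_apply, hf, BTensor.evalLeft_map]

end Coefficients

/-! ## The canonical map is an isomorphism -/

section CanIso

variable {A : Type u} {C : Type v} [Ring A] [AddCommGroup C] [Module A C] [Module Aᵐᵒᵖ C]
  [SMulCommClass A Aᵐᵒᵖ C] [Coring A C]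

theorem can_smul {M : Type*} [AddCommGroup M] [Module Aᵐᵒᵖ M] [RightComodule A C M] (a : A)
    (z : BTensor (↥(colinearEnd A C M)) (RDual A M) M) :
    can A C M (a • z) = a • can A C M z := by
  induction z using BTensor.induction_on with
  | zero => simp only [smul_zero, map_zero]
  | add a b ha hb => simp only [smul_add, map_add, ha, hb]
  | tmul φ u =>
    rw [BTensor.left_smul_tmul, can_tmul, can_tmul]
    generalize RightComodule.coact (A := A) (C := C) u = z
    induction z using BTensor.induction_on with
    | zero => simp only [smul_zero, map_zero]
    | add a b ha hb => simp only [smul_add, map_add, ha, hb]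
    | tmul m c => exact mul_smul a (φ m) c

theorem can_op_smul {M : Type*} [AddCommGroup M] [Module Aᵐᵒᵖ M] [RightComodule A C M] (a : Aᵐᵒᵖ)
    (z : BTensor (↥(colinearEnd A C M)) (RDual A M) M) :
    can A C M (a • z) = a • can A C M z := by
  induction z using BTensor.induction_on with
  | zero => simp only [smul_zero, map_zero]
  | add a b ha hb => simp only [smul_add, map_add, ha, hb]
  | tmul φ u => exact (coeffMap C φ).map_smul a u

/-- The canonical map of a coproduct of finitely generated projective comodules is a homomorphism
of corings. -/
theorem can_isHom {ι : Type x} [DecidableEq ι] (P : ι → Type w) [∀ i, AddCommGroup (P i)]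
    [∀ i, Module Aᵐᵒᵖ (P i)] [∀ i, RightComodule A C (P i)] [∀ i, Module.Finite Aᵐᵒᵖ (P i)]
    [∀ i, Module.Projective Aᵐᵒᵖ (P i)] : Coring.IsHom (A := A) (can A C (⨁ i, P i)) where
  map_smul := can_smul
  map_op_smul := can_op_smul
  counit_map z := by
    induction z using BTensor.induction_on with
    | zero => simp only [map_zero]
    | add a b ha hb => simp only [map_add, ha, hb]
    | tmul φ u => exact counit_coeffMap φ u
  comul_map z := by
    induction z using Comatrix.carrier_induction with
    | zero => simp only [map_zero]
    | add a b ha hb => simp only [map_add, ha, hb]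
    | tmul φ i p =>
      -- The coaction of `C` on itself is `Δ`, so colinearity of `coeffMap C φ` computes `Δ` on its
      -- values.
      have hl : Coring.comul (A := A) (can A C (⨁ i, P i)
          (BTensor.tmul (↥(colinearEnd A C (⨁ i, P i))) φ (Comatrix.inj A P i p)))
          = BTensor.map (coeffMap C φ ∘ₗ Comatrix.inj A P i) LinearMap.id
            (RightComodule.coact (A := A) (C := C) p) :=
        (isColinear_coeffMap φ).comp (isColinear_inj i) p
      have hr : Coring.comul (A := A)
          (BTensor.tmul (↥(colinearEnd A C (⨁ i, P i))) φ (Comatrix.inj A P i p))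
          = _ := Comatrix.comul_tmul_inj _ i φ p
      rw [hl, hr, map_sum]
      simp only [BTensor.map_tmul]
      -- Since `π_i` is colinear, the second tensor factor can be computed inside `P i`.
      have hk : ∀ k, can A C (⨁ i, P i) (BTensor.tmul (↥(colinearEnd A C (⨁ i, P i)))
            ((dualBasis A (P i)).d k ∘ₗ Comatrix.proj A P i) (Comatrix.inj A P i p))
          = BTensor.evalLeft ((dualBasis A (P i)).d k)
              (RightComodule.coact (A := A) (C := C) p) := fun k => by
        have h := coeffMap_comp (isColinear_proj (A := A) (C := C) (P := P) i)
          ((dualBasis A (P i)).d k) (Comatrix.inj A P i p)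
        rw [Comatrix.proj_inj] at h
        exact h
      change _ = ∑ k, BTensor.tmul A (coeffMap C φ (Comatrix.inj A P i ((dualBasis A (P i)).e k)))
        (can A C (⨁ i, P i) (BTensor.tmul (↥(colinearEnd A C (⨁ i, P i)))
            ((dualBasis A (P i)).d k ∘ₗ Comatrix.proj A P i) (Comatrix.inj A P i p)))
      simp only [hk]
      generalize RightComodule.coact (A := A) (C := C) p = z
      induction z using BTensor.induction_on with
      | zero => simp only [map_zero, BTensor.tmul_zero, Finset.sum_const_zero]
      | add a b ha hb => simp only [map_add, BTensor.tmul_add, Finset.sum_add_distrib, ha, hb]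
      | tmul q c =>
        -- The scalars `e_k*(q)` cross the tensor sign to the left factor, where the dual basis
        -- identity reassembles `q`.
        simp only [BTensor.evalLeft_tmul, ← BTensor.smul_tmul, ← map_smul]
        rw [← BTensor.sum_tmul, ← map_sum, ← map_sum, (dualBasis A (P i)).sum_eq]
        rfl

/-- The index type lies in `Type`, so that the power of `Σ` indexed by it stays in the universe for
which the generating property is assumed. -/
theorem BTensor.exists_eq_sum {R : Type*} [Ring R] {M N : Type*} [AddCommGroup M] [Module Rᵐᵒᵖ M]
    [AddCommGroup N] [Module R N] (z : BTensor R M N) :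
    ∃ (κ : Type) (_ : Fintype κ) (m : κ → M) (n : κ → N), z = ∑ k, BTensor.tmul R (m k) (n k) := by
  induction z using BTensor.induction_on with
  | zero => exact ⟨Empty, inferInstance, Empty.elim, Empty.elim, by simp⟩
  | tmul m n => exact ⟨Unit, inferInstance, fun _ => m, fun _ => n, by simp⟩
  | add a b ha hb =>
    obtain ⟨κ, _, m, n, rfl⟩ := ha
    obtain ⟨κ', _, m', n', rfl⟩ := hb
    exact ⟨κ ⊕ κ', inferInstance, Sum.elim m m', Sum.elim n n', by simp⟩

end CanIso

/-! ### The comodule map from a power of `M` to `C` attached to a family of functionals. -/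

section SumCoeffMap

variable {A : Type u} {C : Type v} [Ring A] [AddCommGroup C] [Module A C] [Module Aᵐᵒᵖ C]
  [SMulCommClass A Aᵐᵒᵖ C] [Coring A C] {κ : Type x} [DecidableEq κ]
  {M : Type w} [AddCommGroup M] [Module Aᵐᵒᵖ M] [RightComodule A C M]

variable (C) in
/-- The map `(m_k)_k ↦ ∑_k (φ_k ⊗_A C) ρ_M(m_k)`. -/
def sumCoeffMap (φ : κ → RDual A M) : (⨁ _ : κ, M) →ₗ[Aᵐᵒᵖ] C :=
  DirectSum.toModule Aᵐᵒᵖ κ C fun k => coeffMap C (φ k)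

theorem sumCoeffMap_comp_inj (φ : κ → RDual A M) (k : κ) :
    sumCoeffMap C φ ∘ₗ Comatrix.inj A (fun _ : κ => M) k = coeffMap C (φ k) :=
  LinearMap.ext fun x => DirectSum.toModule_lof Aᵐᵒᵖ (φ := fun k => coeffMap C (φ k)) k x

theorem isColinear_sumCoeffMap (φ : κ → RDual A M) : IsColinear A C (sumCoeffMap C φ) :=
  isColinear_of_comp_inj fun k => by
    rw [sumCoeffMap_comp_inj]; exact isColinear_coeffMap _

theorem sumCoeffMap_apply [Fintype κ] (φ : κ → RDual A M) (d : ⨁ _ : κ, M) :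
    sumCoeffMap C φ d = ∑ k, coeffMap C (φ k) (Comatrix.proj A (fun _ : κ => M) k d) := by
  obtain ⟨G, hG⟩ := Comatrix.exists_sum_inj_proj (A := A) d
  conv_lhs => rw [← hG Finset.univ (Finset.subset_univ G), map_sum]
  exact Finset.sum_congr rfl fun k _ => LinearMap.congr_fun (sumCoeffMap_comp_inj φ k) _

/-- The counit sends the value of `sumCoeffMap C φ` at `d` to `∑ φ_k(d_k)`, so a map into the kernel
gives a relation among the `φ_k`. -/
theorem sum_comp_eq_zero [Fintype κ] {X : Type*} [AddCommGroup X] [Module Aᵐᵒᵖ X]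
    (φ : κ → RDual A M) (g : X →ₗ[Aᵐᵒᵖ] ⨁ _ : κ, M)
    (hg : ∀ x, g x ∈ LinearMap.ker (sumCoeffMap C φ)) :
    ∑ k, φ k ∘ₗ (Comatrix.proj A (fun _ : κ => M) k ∘ₗ g) = 0 := LinearMap.ext fun x => by
  have h := hg x
  rw [LinearMap.mem_ker, sumCoeffMap_apply] at h
  have h' := congrArg (Coring.counit (A := A)) h
  simp only [map_sum, counit_coeffMap, map_zero] at h'
  rw [LinearMap.sum_apply]
  exact h'

/-- A tensor `∑_k φ_k ⊗_T t_k(u)` vanishes when the `t_k` are the components of a comodule map into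
the kernel of `sumCoeffMap`. -/
theorem sum_tmul_colinear_eq_zero [Fintype κ] (φ : κ → RDual A M) (g : M →ₗ[Aᵐᵒᵖ] ⨁ _ : κ, M)
    (hgc : IsColinear A C g) (hg : ∀ x, g x ∈ LinearMap.ker (sumCoeffMap C φ)) (u : M) :
    ∑ k, BTensor.tmul (↥(colinearEnd A C M)) (φ k)
      (Comatrix.proj A (fun _ : κ => M) k (g u)) = 0 := by
  -- Each component of `g` is a colinear endomorphism of `M`, so it may be moved across the tensor
  -- product over `T`.
  have e : ∀ k, BTensor.tmul (↥(colinearEnd A C M)) (φ k)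
      (Comatrix.proj A (fun _ : κ => M) k (g u))
      = BTensor.tmul (↥(colinearEnd A C M))
        (φ k ∘ₗ (Comatrix.proj A (fun _ : κ => M) k ∘ₗ g)) u := fun k =>
    (BTensor.smul_tmul (⟨Comatrix.proj A (fun _ : κ => M) k ∘ₗ g,
      (isColinear_proj k).comp hgc⟩ : ↥(colinearEnd A C M)) (φ k) u).symm
  rw [Finset.sum_congr rfl fun k _ => e k, ← BTensor.sum_tmul, sum_comp_eq_zero φ g hg,
    BTensor.zero_tmul]

end SumCoeffMap

/-! ### Bijectivity of the canonical map for a generating family. -/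

section CanBijective

variable {A C : Type u} [Ring A] [AddCommGroup C] [Module A C] [Module Aᵐᵒᵖ C]
  [SMulCommClass A Aᵐᵒᵖ C] [Coring A C] {ι : Type u} [DecidableEq ι]
  {P : ι → RightComod.{u, u, u} A C}

theorem IsGenerating.can_surjective [Module.Projective A C] (hP : IsGenerating P) :
    Function.Surjective (can A C (⨁ i, P i)) := fun c => by
  refine hP.induction (N := ⟨C⟩) (p := fun c => ∃ z, can A C (⨁ i, P i) z = c) c
    ⟨0, map_zero _⟩ (fun i h hh x => ?_) ?_
  -- A comodule map `h : P i → C` is the coefficient map of `ε h`; composing with `π_i` extends this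
  -- functional to `Σ`.
  · refine ⟨BTensor.tmul _ ((counitR A C ∘ₗ h) ∘ₗ Comatrix.proj A (fun i => P i) i)
      (Comatrix.inj A (fun i => P i) i x), ?_⟩
    have e := coeffMap_comp (isColinear_proj (A := A) (C := C) (P := fun i => P i) i)
      (counitR A C ∘ₗ h) (Comatrix.inj A (fun i => P i) i x)
    rw [Comatrix.proj_inj, coeffMap_counit_comp hh] at e
    exact e
  · rintro _ _ ⟨a, rfl⟩ ⟨b, rfl⟩
    exact ⟨a + b, map_add _ _ _⟩

/-- The kernel is itself a comodule, hence a sum of images of the `P i`, and the expression is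
additive in `d`. It therefore suffices to treat `d` in the image of one comodule map from some `P
i`. -/
theorem IsGenerating.sum_tmul_proj_eq_zero [IsSemisimpleRing A] (hP : IsGenerating P)
    {κ : Type} [Fintype κ] [DecidableEq κ] (φ : κ → RDual A (⨁ i, P i))
    (d : ⨁ _ : κ, ⨁ i, P i) (hd : d ∈ LinearMap.ker (sumCoeffMap C φ)) :
    ∑ k, BTensor.tmul (↥(colinearEnd A C (⨁ i, P i))) (φ k)
      (Comatrix.proj A (fun _ : κ => ⨁ i, P i) k d) = 0 := by
  have : Module.Projective A C := Module.projective_of_isSemisimpleRing A C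
  let K := LinearMap.ker (sumCoeffMap C φ)
  have hK : IsSubcomodule A C (LinearMap.range K.subtype) := by
    rw [Submodule.range_subtype]; exact (isColinear_sumCoeffMap φ).isSubcomodule_ker
  obtain ⟨_, hj⟩ := exists_rightComodule_of_injective K.subtype K.subtype_injective hK
  refine hP.induction (N := ⟨K⟩) (p := fun n => ∑ k,
    BTensor.tmul (↥(colinearEnd A C (⨁ i, P i))) (φ k)
      (Comatrix.proj A (fun _ : κ => ⨁ i, P i) k (K.subtype n)) = 0) ⟨d, hd⟩ ?_
    (fun i h hh x => ?_) fun a b ha hb => ?_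
  · refine Finset.sum_eq_zero fun k _ => ?_
    rw [map_zero, map_zero, BTensor.tmul_zero]
  -- Precomposing `h` with `π_i` gives a comodule map on all of `Σ`, whose components belong to `T`;
  -- evaluating it at `ι_i(x)` recovers `h x`.
  · have hg := sum_tmul_colinear_eq_zero φ
      (K.subtype ∘ₗ h ∘ₗ Comatrix.proj A (fun i => P i) i)
      (hj.comp (hh.comp (isColinear_proj i))) (fun y => (h _).2)
      (Comatrix.inj A (fun i => P i) i x)
    simp only [LinearMap.comp_apply (K.subtype), LinearMap.comp_apply h, Comatrix.proj_inj] at hg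
    exact hg
  · simp only [map_add, BTensor.tmul_add, Finset.sum_add_distrib]
    rw [ha, hb, add_zero]

theorem IsGenerating.can_injective [IsSemisimpleRing A] (hP : IsGenerating P) :
    Function.Injective (can A C (⨁ i, P i)) := by
  classical
  rw [injective_iff_map_eq_zero]
  intro z hz
  obtain ⟨κ, _, φ, u, rfl⟩ := BTensor.exists_eq_sum z
  -- The right legs are collected into one element of the power, so that vanishing under `can`
  -- becomes membership in the kernel of `sumCoeffMap C φ`.
  let d : ⨁ _ : κ, ⨁ i, P i := ∑ k, Comatrix.inj A (fun _ : κ => ⨁ i, P i) k (u k)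
  have hd : ∀ k, Comatrix.proj A (fun _ : κ => ⨁ i, P i) k d = u k := fun k => by
    rw [map_sum, Finset.sum_eq_single k, Comatrix.proj_inj]
    · intro l _ hl
      rw [DirectSum.component.of, dif_neg hl]
    · intro h; exact absurd (Finset.mem_univ k) h
  have hdF : d ∈ LinearMap.ker (sumCoeffMap C φ) := by
    rw [LinearMap.mem_ker, sumCoeffMap_apply]
    simp only [hd]
    rw [map_sum] at hz
    exact hz
  have h := hP.sum_tmul_proj_eq_zero φ d hdF
  simp only [hd] at h
  exact h

theorem IsGenerating.canIsIso [IsSemisimpleRing A] (hP : IsGenerating P)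
    [∀ i, Module.Finite Aᵐᵒᵖ (P i)] : CanIsIso P := by
  have : Module.Projective A C := Module.projective_of_isSemisimpleRing A C
  exact ⟨can_isHom fun i => P i, hP.can_injective, hP.can_surjective⟩

end CanBijective

/-! ## Finite-dimensional comodules generate -/

section FiniteGenerators

variable (K C : Type u) [Field K] [AddCommGroup C] [Module K C] [Module Kᵐᵒᵖ C]
  [SMulCommClass K Kᵐᵒᵖ C] [Coring K C]

/-- The family of all comodules with underlying space `Kⁿ`. -/
def finiteComodules (s : Σ n : ℕ, RightComodule K C (Fin n → Kᵐᵒᵖ)) : RightComod.{u, u, u} K C :=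
  letI := s.2
  ⟨Fin s.1 → Kᵐᵒᵖ⟩

instance (s : Σ n : ℕ, RightComodule K C (Fin n → Kᵐᵒᵖ)) :
    Module.Finite Kᵐᵒᵖ (finiteComodules K C s) :=
  inferInstanceAs (Module.Finite Kᵐᵒᵖ (Fin s.1 → Kᵐᵒᵖ))

/-- Two maps that differ at `m` already differ on the subcomodule generated by `m`, which is
finite-dimensional. Using all coactions on the fixed spaces `Kⁿ` keeps the index type in `Type u`.
-/
theorem isGenerating_finiteComodules : IsGenerating (finiteComodules K C) := by
  intro M N f g _ _ hfg
  have : Module.Projective K C := Module.projective_of_isSemisimpleRing K C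
  obtain ⟨m, hm⟩ : ∃ m, f m ≠ g m := by
    by_contra! h
    exact hfg (LinearMap.ext h)
  let L : Submodule Kᵐᵒᵖ M := cyclicSubcomodule K C m
  have : Module.Finite Kᵐᵒᵖ L := Module.Finite.iff_fg.2 (fg_cyclicSubcomodule m)
  -- A basis replaces the cyclic subcomodule by a coordinate space, so that it becomes a member of
  -- the family.
  let e : L ≃ₗ[Kᵐᵒᵖ] (Fin (Module.finrank Kᵐᵒᵖ L) → Kᵐᵒᵖ) := (Module.finBasis Kᵐᵒᵖ L).equivFun
  let j := L.subtype ∘ₗ e.symm.toLinearMap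
  have hj : Function.Injective j := L.subtype_injective.comp e.symm.injective
  have hr : LinearMap.range j = L := by
    rw [LinearMap.range_comp, LinearEquiv.range, Submodule.map_top, Submodule.range_subtype]
  obtain ⟨c, hc⟩ := exists_rightComodule_of_injective (A := K) (C := C) j hj
    (by rw [hr]; exact isSubcomodule_cyclicSubcomodule m)
  refine ⟨⟨_, c⟩, j, hc, fun h => hm ?_⟩
  obtain ⟨y, hy⟩ : m ∈ LinearMap.range j := by rw [hr]; exact mem_cyclicSubcomodule m
  rw [← hy]
  exact LinearMap.congr_fun h y

end FiniteGenerators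

/-! ### The theorem for corings and its case of coalgebras. -/

theorem mainTheorem7 :
    -- Corings over a semisimple artinian ring.
    (∀ (A C : Type u) [Ring A] [IsSemisimpleRing A] [AddCommGroup C] [Module A C]
        [Module Aᵐᵒᵖ C] [SMulCommClass A Aᵐᵒᵖ C] [Coring A C]
        (ι : Type u) [DecidableEq ι] (P : ι → RightComod.{u, u, u} A C),
        (∀ i, IsFinGenComodule A C (P i)) → IsGenerating P →
        ∃ _ : ∀ i, Module.Finite Aᵐᵒᵖ (P i), CanIsIso P) ∧
    -- Coalgebras over a field.
    (∀ (K C : Type u) [Field K] [AddCommGroup C] [Module K C] [Module Kᵐᵒᵖ C]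
        [IsCentralScalar K C] [Coalgebra K C],
        (∃ (ι : Type u) (P : ι → RightComod.{u, u, u} K C),
          (∀ i, Module.Finite Kᵐᵒᵖ (P i)) ∧ IsGenerating P) ∧
        ∀ (ι : Type u) [DecidableEq ι] (P : ι → RightComod.{u, u, u} K C)
          [∀ i, Module.Finite Kᵐᵒᵖ (P i)], IsGenerating P → CanIsIso P) := by
  constructor
  · intro A C _ _ _ _ _ _ _ ι _ P hfg hP
    have : Module.Projective A C := Module.projective_of_isSemisimpleRing A C
    have : ∀ i, Module.Finite Aᵐᵒᵖ (P i) := fun i => (hfg i).finite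
    exact ⟨this, hP.canIsIso⟩
  · intro K C _ _ _ _ _ _
    exact ⟨⟨_, finiteComodules K C, fun _ => inferInstance, isGenerating_finiteComodules K C⟩,
      fun ι _ P _ hP => hP.canIsIso⟩
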